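/- **Constraints.** A constraint of arity $k$ is a function $f:\{0,1\}^k\to\mathbb{R}^{\ge 0}$; for $k=2$ we write $f=(f(00),f(01),f(10),f(11))$. Let $\mathcal{U}$ be the set of all unary constraints, and let $IM_{opt}$ be the set of all constraints $f(x_1,\dots,x_k)$ that are finite products of unary constraints $u(x_i)$ and of binary constraints $(1,1,\lambda,1)$ with $0\le\lambda<1$, applied to pairs $(x_i,x_j)$. **Problems.** For a set $\mathcal{F}$ of constraints, MAX-PROD-CSP$^*(\mathcal{F})$ is the following maximization problem. An instance is a number $n$ of Boolean variables $x_1,\dots,x_n$ and a finite set $H$ of pairs $\langle h,(x_{i_1},\dots,x_{i_k})\rangle$ with $h\in\mathcal{F}\cup\mathcal{U}$ of arity $k$ and $i_1,\dots,i_k\in[n]$; a solution is an assignment $\sigma:\{x_1,\dots,x_n\}\to\{0,1\}$; its measure is $\prod_{\langle h,(x_{i_1},\dots,x_{i_k})\rangle\in H}h(\sigma(x_{i_1}),\dots,\sigma(x_{i_k}))$. In MAX-PROD-FLOW an instance is a finite directed graph $G=(V,E)$ with flow rates $\rho_e\ge 1$ $(e\in E)$ and influx rates $w_v\ge 0$ $(v\in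 V)$; a solution is an assignment $\sigma:V\to\{0,1\}$; its measure is $\bigl(\prod_{(x,y)\in E,\ \sigma(x)\ge\sigma(y)}\rho_{(x,y)}\bigr)\bigl(\prod_{z\in V,\ \sigma(z)=1}w_z\bigr)$. **Computation.** Algorithms are programs of a real RAM with exact unit-cost real arithmetic and comparisons (no rounding), natural-number registers and addresses, and fair random bits. Instances are given as finite sequences of natural and real numbers, and the size $|x|$ is the length of that sequence. Variables and vertices are listed, each constraint is given by the table of its $2^k$ values in lexicographic order together with the list of its arguments, and each edge is given by its two ends and its rate. **Reducibility.** For a maximization problem with measure $m$ and optimum value $m^*$, a solution $y$ of $x$ is $\alpha$-approximate if $1/\alpha\le|m(x,y)/m^*(x)|\le\alpha$, or $m(x,y)=0$ in the case $m^*(x)=0$. A randomized approximation scheme takes an instance $x$ and $\varepsilon\in(0,1)$, and outputs a $2^{\varepsilon}$-approximate solution of $x$ with probability at least $3/4$. A problem $P$ is APT-reducible to a problem $Q$ if there are a randomized oracle algorithm $N$ and two polynomials $p,r$ in two variables such that, for every (not necessarily time-bounded) randomized approximation scheme $M$ for $Q$ used as oracle: (i) $N$ is a randomized approximation scheme for $P$;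 (ii) on input $(x,\varepsilon)$, every oracle call is of the form $(w,\delta)$ with $w$ an instance of $Q$, $\delta\in(0,1)$ and $1/\delta\le p(|x|,1/\varepsilon)$, and it is answered by a fresh random outcome of $M$ on $(w,\delta)$; (iii) the running time of $N$ on $(x,\varepsilon)$ is at most $r(|x|,1/\varepsilon)$. **Lemma.** For every set $\mathcal{F}\subseteq IM_{opt}$ of constraints, MAX-PROD-CSP$^*(\mathcal{F})$ is APT-reducible to MAX-PROD-FLOW. -/

import Mathlib

open scoped NNReal ENNReal

namespace ProdCSP

/-! ### Words, and a randomized real RAM with an oracle -/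

/-- Machine data: a finite sequence of natural numbers together with a finite sequence of
real numbers. Every entry has unit size. -/
structure Word where
  nats : List ℕ
  reals : List ℝ

/-- The size of a word is its total number of entries. -/
def Word.size (w : Word) : ℕ := w.nats.length + w.reals.length

/-- Expressions with natural-number values: literals, registers, arithmetic (`sub` is truncated),
array access by a computed address, and array lengths. -/
inductive NExp where
  | lit (c : ℕ)
  | reg (v : ℕ)
  | add (a b : NExp)
  | sub (a b : NExp)
  | mul (a b : NExp)
  | get (arr : ℕ) (i : NExp)
  | lenN (arr : ℕ)
  | lenR (arr : ℕ)

/-- Expressions with real values. The only constants are natural numbers, and there is no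
rounding operation. -/
inductive RExp where
  | lit (c : ℕ)
  | reg (v : ℕ)
  | cast (a : NExp)
  | add (a b : RExp)
  | sub (a b : RExp)
  | mul (a b : RExp)
  | div (a b : RExp)
  | get (arr : ℕ) (i : NExp)

/-- Tests. -/
inductive BExp where
  | ltN (a b : NExp)
  | eqN (a b : NExp)
  | ltR (a b : RExp)
  | eqR (a b : RExp)
  | neg (p : BExp)
  | conj (p q : BExp)

/-- Programs of the machine. -/
inductive Stmt where
  | skip
  /-- assignment to a natural-number register -/
  | assignN (v : ℕ) (e : NExp)
  /-- assignment to a real register -/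
  | assignR (v : ℕ) (e : RExp)
  /-- append an entry to an array of natural numbers -/
  | pushN (arr : ℕ) (e : NExp)
  /-- append an entry to an array of reals -/
  | pushR (arr : ℕ) (e : RExp)
  /-- overwrite an existing entry of an array of natural numbers -/
  | setN (arr : ℕ) (i e : NExp)
  /-- overwrite an existing entry of an array of reals -/
  | setR (arr : ℕ) (i : NExp) (e : RExp)
  /-- empty an array of natural numbers -/
  | clearN (arr : ℕ)
  /-- empty an array of reals -/
  | clearR (arr : ℕ)
  /-- put a fair random bit into a natural-number register -/
  | flip (v : ℕ)
  /-- call the oracle on the word stored in the two arrays with name `q` and the tolerance given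
  by `e`; the answer replaces the two arrays with name `a` -/
  | query (q a : ℕ) (e : RExp)
  | seq (s t : Stmt)
  | ite (b : BExp) (s t : Stmt)
  | loop (b : BExp) (s : Stmt)

/-- The memory: registers and dynamic arrays, for natural numbers and for reals. -/
structure Mem where
  nreg : ℕ → ℕ
  rreg : ℕ → ℝ
  narr : ℕ → List ℕ
  rarr : ℕ → List ℝ

/-- The word stored in the two arrays with name `a`. -/
def Mem.word (s : Mem) (a : ℕ) : Word := ⟨s.narr a, s.rarr a⟩

/-- Replace the two arrays with name `a`. -/
def Mem.load (s : Mem) (a : ℕ) (w : Word) : Mem :=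
  { s with narr := Function.update s.narr a w.nats, rarr := Function.update s.rarr a w.reals }

/-- Reading beyond the end of an array gives `0`. -/
def NExp.eval (s : Mem) : NExp → ℕ
  | .lit c => c
  | .reg v => s.nreg v
  | .add a b => a.eval s + b.eval s
  | .sub a b => a.eval s - b.eval s
  | .mul a b => a.eval s * b.eval s
  | .get arr i => (s.narr arr).getD (i.eval s) 0
  | .lenN arr => (s.narr arr).length
  | .lenR arr => (s.rarr arr).length

/-- Division by zero and reading beyond the end of an array give `0`. -/
noncomputable def RExp.eval (s : Mem) : RExp → ℝ
  | .lit c => c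
  | .reg v => s.rreg v
  | .cast a => a.eval s
  | .add a b => a.eval s + b.eval s
  | .sub a b => a.eval s - b.eval s
  | .mul a b => a.eval s * b.eval s
  | .div a b => a.eval s / b.eval s
  | .get arr i => (s.rarr arr).getD (i.eval s) 0

noncomputable def BExp.eval (s : Mem) : BExp → Bool
  | .ltN a b => decide (a.eval s < b.eval s)
  | .eqN a b => decide (a.eval s = b.eval s)
  | .ltR a b => decide (a.eval s < b.eval s)
  | .eqR a b => decide (a.eval s = b.eval s)
  | .neg p => !p.eval s
  | .conj p q => p.eval s && q.eval s

/-- A configuration: the stack of statements still to be executed, and the memory. -/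
structure Cfg where
  todo : List Stmt
  mem : Mem

/-- An oracle returns a random word on each pair of a word and a tolerance. Different calls are
answered independently. -/
abbrev Oracle := Word → ℝ → PMF Word

/-- One step of the machine. A configuration with nothing left to execute has halted and is
left unchanged. -/
noncomputable def step (M : Oracle) (c : Cfg) : PMF Cfg :=
  match c.todo with
  | [] => PMF.pure c
  | .skip :: k => PMF.pure ⟨k, c.mem⟩
  | .assignN v e :: k =>
      PMF.pure ⟨k, { c.mem with nreg := Function.update c.mem.nreg v (e.eval c.mem) }⟩
  | .assignR v e :: k =>
      PMF.pure ⟨k, { c.mem with rreg := Function.update c.mem.rreg v (e.eval c.mem) }⟩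
  | .pushN arr e :: k =>
      PMF.pure ⟨k, { c.mem with
        narr := Function.update c.mem.narr arr (c.mem.narr arr ++ [e.eval c.mem]) }⟩
  | .pushR arr e :: k =>
      PMF.pure ⟨k, { c.mem with
        rarr := Function.update c.mem.rarr arr (c.mem.rarr arr ++ [e.eval c.mem]) }⟩
  | .setN arr i e :: k =>
      PMF.pure ⟨k, { c.mem with
        narr := Function.update c.mem.narr arr
          ((c.mem.narr arr).set (i.eval c.mem) (e.eval c.mem)) }⟩
  | .setR arr i e :: k =>
      PMF.pure ⟨k, { c.mem with
        rarr := Function.update c.mem.rarr arr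
          ((c.mem.rarr arr).set (i.eval c.mem) (e.eval c.mem)) }⟩
  | .clearN arr :: k =>
      PMF.pure ⟨k, { c.mem with narr := Function.update c.mem.narr arr [] }⟩
  | .clearR arr :: k =>
      PMF.pure ⟨k, { c.mem with rarr := Function.update c.mem.rarr arr [] }⟩
  | .flip v :: k =>
      (PMF.uniformOfFintype Bool).map fun b =>
        ⟨k, { c.mem with nreg := Function.update c.mem.nreg v (if b then 1 else 0) }⟩
  | .query q a e :: k =>
      (M (c.mem.word q) (e.eval c.mem)).map fun w => ⟨k, c.mem.load a w⟩
  | .seq s t :: k => PMF.pure ⟨s :: t :: k, c.mem⟩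
  | .ite b s t :: k => PMF.pure ⟨(if b.eval c.mem then s else t) :: k, c.mem⟩
  | .loop b s :: k => PMF.pure ⟨if b.eval c.mem then s :: .loop b s :: k else k, c.mem⟩

/-- The distribution of the configuration after `t` steps. -/
noncomputable def run (M : Oracle) : ℕ → Cfg → PMF Cfg
  | 0, c => PMF.pure c
  | t + 1, c => (step M c).bind (run M t)

/-- The initial configuration: the input word is in the arrays with name `0`, the tolerance is in
the real register `0`, and everything else is zero or empty. -/
noncomputable def initCfg (prog : Stmt) (w : Word) (ε : ℝ) : Cfg :=
  ⟨[prog], Mem.load ⟨fun _ => 0, fun v => if v = 0 then ε else 0, fun _ => [], fun _ => []⟩ 0 w⟩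

def Cfg.Halted (c : Cfg) : Prop := c.todo = []

/-- The output is the content of the arrays with name `1`. -/
def Cfg.output (c : Cfg) : Word := c.mem.word 1

/-- The next step of `c` is an oracle call, on the word `w` with tolerance `δ`. -/
def Cfg.Asks (c : Cfg) (w : Word) (δ : ℝ) : Prop :=
  ∃ q a e k, c.todo = .query q a e :: k ∧ w = c.mem.word q ∧ δ = e.eval c.mem

/-! ### Maximization problems and approximation-preserving Turing reductions -/

/-- A maximization problem, with instances and solutions represented by words. -/
structure MaxProblem where
  Inst : Type
  Sol : Inst → Type
  measure : (x : Inst) → Sol x → ℝ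
  encInst : Inst → Word
  encSol : (x : Inst) → Sol x → Word

namespace MaxProblem

/-- The size of an instance is the size of the word that represents it. -/
def size (P : MaxProblem) (x : P.Inst) : ℕ := (P.encInst x).size

/-- `v` is the optimum value of the instance `x`. -/
def IsOptimum (P : MaxProblem) (x : P.Inst) (v : ℝ) : Prop :=
  IsGreatest (Set.range (P.measure x)) v

/-- `y` is an `α`-approximate solution for `x`. -/
def IsApprox (P : MaxProblem) (α : ℝ) (x : P.Inst) (y : P.Sol x) : Prop :=
  ∃ v, P.IsOptimum x v ∧
    (v = 0 → P.measure x y = 0) ∧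
    (v ≠ 0 → 1 / α ≤ |P.measure x y / v| ∧ |P.measure x y / v| ≤ α)

/-- A random word that represents a `2 ^ ε`-approximate solution for `x` with probability at
least `3/4`. -/
def GoodOutput (P : MaxProblem) (x : P.Inst) (ε : ℝ) (d : PMF Word) : Prop :=
  3 / 4 ≤ d.toOuterMeasure
    {w : Word | ∃ y : P.Sol x, P.encSol x y = w ∧ P.IsApprox ((2 : ℝ) ^ ε) x y}

/-- `M` acts as a randomized approximation scheme for `P`: nothing is said about words that do not
represent instances, about tolerances outside `(0,1)`, or about the remaining answers. -/
def IsScheme (P : MaxProblem) (M : Oracle) : Prop :=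
  ∀ (x : P.Inst) (ε : ℝ), 0 < ε → ε < 1 → P.GoodOutput x ε (M (P.encInst x) ε)

/-- The value of a polynomial in two variables at `(|x|, 1/ε)`. -/
noncomputable def bound (P : MaxProblem) (p : MvPolynomial (Fin 2) ℝ) (x : P.Inst) (ε : ℝ) : ℝ :=
  MvPolynomial.eval ![(P.size x : ℝ), 1 / ε] p

/-- Polynomial-time randomized approximation-preserving Turing reducibility of `P` to `Q`. The
program and the polynomials do not depend on the oracle, the instance or the tolerance. -/
def APTReducible (P Q : MaxProblem) : Prop :=
  ∃ (prog : Stmt) (p r : MvPolynomial (Fin 2) ℝ),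
    ∀ M : Oracle, Q.IsScheme M →
      ∀ (x : P.Inst) (ε : ℝ), 0 < ε → ε < 1 →
        -- every oracle call on every computation path is admissible
        (∀ t, ∀ c ∈ (run M t (initCfg prog (P.encInst x) ε)).support,
          ∀ (w : Word) (δ : ℝ), c.Asks w δ →
            (∃ z : Q.Inst, w = Q.encInst z) ∧ 0 < δ ∧ δ < 1 ∧ 1 / δ ≤ P.bound p x ε) ∧
        -- every computation path halts in polynomial time, and the output is good
        ∃ t : ℕ, (t : ℝ) ≤ P.bound r x ε ∧
          (∀ c ∈ (run M t (initCfg prog (P.encInst x) ε)).support, c.Halted) ∧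
          P.GoodOutput x ε ((run M t (initCfg prog (P.encInst x) ε)).map Cfg.output)

end MaxProblem

/-! ### Constraints -/

/-- A nonnegative-real-weighted Boolean constraint. -/
structure Constraint where
  arity : ℕ
  val : (Fin arity → Bool) → ℝ≥0

/-- The set of all unary constraints. -/
def unaryConstraints : Set Constraint := {f | f.arity = 1}

/-- The values of a function on `{0,1}^k` in lexicographic order of the arguments. -/
def table : (k : ℕ) → ((Fin k → Bool) → ℝ≥0) → List ℝ
  | 0, f => [(f Fin.elim0 : ℝ)]
  | k + 1, f =>
      table k (fun x => f (Fin.cons false x)) ++ table k (fun x => f (Fin.cons true x))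

/-- A unary constraint applied to the variable `x_i`, or the binary constraint `(1,1,lam,1)`
applied to `(x_i, x_j)`. -/
inductive ImFactor (k : ℕ) where
  | unary (i : Fin k) (u : Bool → ℝ≥0)
  | imp (i j : Fin k) (lam : ℝ≥0) (h : lam < 1)

def ImFactor.eval {k : ℕ} (x : Fin k → Bool) : ImFactor k → ℝ≥0
  | .unary i u => u (x i)
  | .imp i j lam _ => if x i = true ∧ x j = false then lam else 1

/-- The constraints that are products of unary constraints and of constraints `(1,1,lam,1)` with
`0 ≤ lam < 1`. -/
def IMopt : Set Constraint :=
  {f | ∃ L : List (ImFactor f.arity), ∀ x, f.val x = (L.map (ImFactor.eval x)).prod}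

/-! ### The problems -/

/-- A Boolean assignment as a word: its bits. -/
def encAssignment {n : ℕ} (σ : Fin n → Bool) : Word :=
  ⟨List.ofFn fun i => if σ i then 1 else 0, []⟩

/-- A constraint applied to a tuple of (not necessarily distinct) variables among `n` ones. -/
structure Application (n : ℕ) where
  h : Constraint
  args : Fin h.arity → Fin n

/-- An instance: a finite set, listed without repetition, of applications to `n` variables of
constraints from `F`. -/
structure CSPInst (F : Set Constraint) where
  n : ℕ
  apps : List (Application n)
  nodup : apps.Nodup
  mem : ∀ a ∈ apps, a.h ∈ F

/-- The natural-number part has the number `n` of variables, the list of the variables, the number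
of applications and, for each of these, its arity and its arguments; the real part has
the value tables of the constraints, one after the other. -/
def CSPInst.enc {F : Set Constraint} (x : CSPInst F) : Word where
  nats := x.n :: (List.range x.n ++ x.apps.length ::
    x.apps.flatMap fun a => a.h.arity :: List.ofFn fun i => (a.args i : ℕ))
  reals := x.apps.flatMap fun a => table a.h.arity a.h.val

/-- The problem MAX-PROD-CSP(F). -/
def maxProdCSP (F : Set Constraint) : MaxProblem where
  Inst := CSPInst F
  Sol x := Fin x.n → Bool
  measure x σ := ((x.apps.map fun a => a.h.val fun i => σ (a.args i)).prod : ℝ≥0)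
  encInst := CSPInst.enc
  encSol _ σ := encAssignment σ

/-- The problem MAX-PROD-CSP*(F), in which all unary constraints are free. -/
def maxProdCSPStar (F : Set Constraint) : MaxProblem := maxProdCSP (F ∪ unaryConstraints)

/-- An instance of MAX-PROD-FLOW: a directed graph on `n` vertices, given by the list, without
repetition, of its edges with their flow rates; and the influx rates of the vertices. -/
structure FlowInst where
  n : ℕ
  edges : List ((Fin n × Fin n) × ℝ)
  nodup : (edges.map Prod.fst).Nodup
  one_le : ∀ e ∈ edges, 1 ≤ e.2
  influx : Fin n → ℝ≥0

/-- The natural-number part has the number of vertices, the number of edges and the two ends of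
each edge; the real part has the influx rates, followed by the flow rates. -/
def FlowInst.enc (x : FlowInst) : Word where
  nats := x.n :: x.edges.length :: x.edges.flatMap fun e => [(e.1.1 : ℕ), (e.1.2 : ℕ)]
  reals := (List.ofFn fun v => (x.influx v : ℝ)) ++ x.edges.map Prod.snd

/-- The problem MAX-PROD-FLOW. -/
def maxProdFlow : MaxProblem where
  Inst := FlowInst
  Sol x := Fin x.n → Bool
  measure x σ :=
    ((x.edges.filter fun e => decide (σ e.1.1 ≥ σ e.1.2)).map Prod.snd).prod *
      ∏ z : Fin x.n with σ z = true, (x.influx z : ℝ)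
  encInst := FlowInst.enc
  encSol _ σ := encAssignment σ

end ProdCSP

/-! On its support, a constraint `f` of `IMopt` has the form `c · ∏ a_p^(x_p) · ∏ b_pq^(x_p x_q)`
with all `b_pq ≥ 1`. A unary factor contributes to `c` and to one `a_p`. For `λ > 0` the factor
`(1,1,λ,1)` equals `λ^(x_i) · (1/λ)^(x_i x_j)`, and for `λ = 0` it is `1` on the support. The
support itself is cut out by the implications and the constant variables that hold on it
(`ne_zero_of_closed`).

An edge `(p,q)` of rate `b ≥ 1` together with an influx factor `b` at `q` contributes `b · b^(x_p
x_q)`. So, up to a constant, `f` agrees on its support with a flow gadget (`exists_flow_form`). The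
zeros of `f` are enforced as follows: a variable that is always false gets influx `0`; an always
true variable has its influx, and an implication from `q` to `p` has the rate of `(p,q)`, multiplied
by a large `K`. Feasible assignments collect every factor `K`; any other assignment misses one or
has measure `0`, and is worse than each feasible one by a factor of at least `2` (`penalty_spec`).
Since `2^ε < 2`, an approximate solution of the flow instance is feasible as soon as anything is,
and on feasible points the two measures are proportional (`isApprox_of_penalty`). Hence one oracle
call with the same `ε` suffices, and its answer is returned unchanged.

An instance gives only the table of `f`, not a factorization, so the parameters must be recovered
from values. After merging variables that agree on the support and dropping constant ones, only
pairs of incomparable representatives interact. Then `a_p` and `b_pq` are quotients of values of `f`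
at explicit sets that are closed under implication (`weight_eq`, `interaction_eq`). The table has
`2^k` entries and is part of the input, so searches over the support take polynomial time.

On the machine side, the flow instance is described by terms all of whose loops run as often as the
input is long. Such terms are compiled once and for all, with a polynomial bound for the running
time (`Cmd.code_exec`, `MaxProblem.APTReducible.of_cmd`); `flowCmd_out` checks that the emitted word
is the encoded flow instance. -/

namespace ProdCSP

/-! ### Deterministic executions -/

/-- `Exec s m m' t`: the statement `s`, which makes no random choice and no oracle call, turns the
memory `m` into `m'` in exactly `t` steps. -/
inductive Exec : Stmt → Mem → Mem → ℕ → Prop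
  | assignN (m : Mem) (v : ℕ) (e : NExp) :
      Exec (.assignN v e) m { m with nreg := Function.update m.nreg v (e.eval m) } 1
  | assignR (m : Mem) (v : ℕ) (e : RExp) :
      Exec (.assignR v e) m { m with rreg := Function.update m.rreg v (e.eval m) } 1
  | pushN (m : Mem) (a : ℕ) (e : NExp) :
      Exec (.pushN a e) m
        { m with narr := Function.update m.narr a (m.narr a ++ [e.eval m]) } 1
  | pushR (m : Mem) (a : ℕ) (e : RExp) :
      Exec (.pushR a e) m
        { m with rarr := Function.update m.rarr a (m.rarr a ++ [e.eval m]) } 1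
  | skip (m : Mem) : Exec .skip m m 1
  | seq {s t : Stmt} {m₁ m₂ m₃ : Mem} {i j : ℕ} :
      Exec s m₁ m₂ i → Exec t m₂ m₃ j → Exec (.seq s t) m₁ m₃ (1 + (i + j))
  | ite {b : BExp} {s t : Stmt} {m m' : Mem} {i : ℕ} :
      Exec (if b.eval m then s else t) m m' i → Exec (.ite b s t) m m' (1 + i)
  | loop_done {b : BExp} {s : Stmt} {m : Mem} :
      b.eval m = false → Exec (.loop b s) m m 1
  | loop_next {b : BExp} {s : Stmt} {m₁ m₂ m₃ : Mem} {i j : ℕ} :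
      b.eval m₁ = true → Exec s m₁ m₂ i → Exec (.loop b s) m₂ m₃ j →
        Exec (.loop b s) m₁ m₃ (1 + (i + j))

theorem run_succ (M : Oracle) (t : ℕ) (c : Cfg) :
    run M (1 + t) c = (step M c).bind (run M t) := by
  rw [Nat.add_comm]; rfl

theorem run_halted (M : Oracle) (t : ℕ) (m : Mem) : run M t ⟨[], m⟩ = PMF.pure ⟨[], m⟩ := by
  induction t with
  | zero => rfl
  | succ t ih => simp [run, step, ih]

/-- The continuation `k` and the number `u` of further steps are arbitrary, so that deterministic
code can be peeled off the front of any program. -/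
theorem Exec.run_eq {s : Stmt} {m m' : Mem} {t : ℕ} (h : Exec s m m' t) (M : Oracle)
    (k : List Stmt) (u : ℕ) : run M (t + u) ⟨s :: k, m⟩ = run M u ⟨k, m'⟩ := by
  induction h generalizing k u with
  | seq _ _ ih₁ ih₂ =>
      rw [Nat.add_assoc, run_succ, Nat.add_assoc]
      simp only [step, PMF.pure_bind]
      rw [ih₁, ih₂]
  | ite _ ih =>
      rw [Nat.add_assoc, run_succ]
      simp only [step, PMF.pure_bind]
      rw [ih]
  | loop_done hb => rw [run_succ]; simp [step, hb]
  | loop_next hb _ _ ih₁ ih₂ =>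
      rw [Nat.add_assoc, run_succ, Nat.add_assoc]
      simp only [step, PMF.pure_bind, hb, if_true]
      rw [ih₁, ih₂]
  | _ => rw [run_succ]; simp [step]

/-- No oracle call is made before a deterministic execution is complete. -/
theorem Exec.not_asks {s : Stmt} {m m' : Mem} {t : ℕ} (h : Exec s m m' t) (M : Oracle)
    (k : List Stmt) (u : ℕ) (c : Cfg) (hc : c ∈ (run M u ⟨s :: k, m⟩).support) :
    (∀ w δ, ¬ c.Asks w δ) ∨ ∃ u', c ∈ (run M u' ⟨k, m'⟩).support := by
  induction h generalizing k u with
  | seq _ _ ih₁ ih₂ =>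
      cases u with
      | zero => left; simp_all [run, Cfg.Asks]
      | succ u =>
        simp only [run, step, PMF.pure_bind] at hc
        rcases ih₁ _ _ hc with h | ⟨u', h⟩
        · exact .inl h
        · exact ih₂ _ _ h
  | ite _ ih =>
      cases u with
      | zero => left; simp_all [run, Cfg.Asks]
      | succ u =>
        simp only [run, step, PMF.pure_bind] at hc
        exact ih _ _ hc
  | loop_next hb _ _ ih₁ ih₂ =>
      cases u with
      | zero => left; simp_all [run, Cfg.Asks]
      | succ u =>
        simp only [run, step, PMF.pure_bind, hb, if_true] at hc
        rcases ih₁ _ _ hc with h | ⟨u', h⟩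
        · exact .inl h
        · exact ih₂ _ _ h
  | loop_done hb =>
      cases u with
      | zero => left; simp_all [run, Cfg.Asks]
      | succ u =>
        right; refine ⟨u, ?_⟩
        simpa [run, step, hb] using hc
  | _ =>
      cases u with
      | zero => left; simp_all [run, Cfg.Asks]
      | succ u =>
        right; refine ⟨u, ?_⟩
        simpa only [run, step, PMF.pure_bind] using hc

/-- Execution within a time bound. -/
def ExecLe (s : Stmt) (m m' : Mem) (b : ℕ) : Prop := ∃ t ≤ b, Exec s m m' t

theorem Exec.le {s : Stmt} {m m' : Mem} {t : ℕ} (h : Exec s m m' t) : ExecLe s m m' t :=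
  ⟨t, le_rfl, h⟩

theorem ExecLe.mono {s : Stmt} {m m' : Mem} {a b : ℕ} (h : ExecLe s m m' a) (hab : a ≤ b) :
    ExecLe s m m' b :=
  let ⟨t, ht, h⟩ := h; ⟨t, ht.trans hab, h⟩

theorem ExecLe.seq {s t : Stmt} {m₁ m₂ m₃ : Mem} {a b : ℕ} (h₁ : ExecLe s m₁ m₂ a)
    (h₂ : ExecLe t m₂ m₃ b) : ExecLe (.seq s t) m₁ m₃ (1 + (a + b)) :=
  let ⟨_, h, e⟩ := h₁; let ⟨_, h', e'⟩ := h₂; ⟨_, by omega, e.seq e'⟩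

theorem ExecLe.ite {b : BExp} {s t : Stmt} {m m' : Mem} {a : ℕ}
    (h : ExecLe (if b.eval m then s else t) m m' a) : ExecLe (.ite b s t) m m' (1 + a) :=
  let ⟨_, h, e⟩ := h; ⟨_, by omega, e.ite⟩

/-- The size of the input word, as long as it is still in the arrays with name `0`. -/
def inputSize (m : Mem) : ℕ := (m.word 0).size

/-- The loop that runs the register `v` from its present value up to the size of the input. -/
def forLoop (v : ℕ) (body : Stmt) : Stmt :=
  .loop (.ltN (.reg v) (.add (.lenN 0) (.lenR 0)))
    (.seq body (.assignN v (.add (.reg v) (.lit 1))))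

/-- A Hoare rule. A turn costs `c + 3`: the test, the unfolding of `seq`, the body and the
increment. The bound is read again from the input arrays at each test, which is why the invariant
must preserve the input size. -/
theorem forLoop_exec {v : ℕ} {body : Stmt} {B c : ℕ} (Inv : ℕ → Mem → Prop)
    (hsize : ∀ i m, Inv i m → inputSize m = B) (hv : ∀ i m, Inv i m → m.nreg v = i)
    (hbody : ∀ i < B, ∀ m, Inv i m → ∃ m', ExecLe body m m' c ∧
      Inv (i + 1) { m' with nreg := Function.update m'.nreg v (m'.nreg v + 1) })
    (m : Mem) (hm : Inv 0 m) :
    ∃ m', ExecLe (forLoop v body) m m' (B * (c + 3) + 1) ∧ Inv B m' := by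
  suffices H : ∀ r i, i + r = B → ∀ m, Inv i m →
      ∃ m', ExecLe (forLoop v body) m m' (r * (c + 3) + 1) ∧ Inv B m' from
    H B 0 (by simp) m hm
  intro r
  induction r with
  | zero =>
    intro i hi m hm
    refine ⟨m, ⟨1, by omega, Exec.loop_done ?_⟩, ?_⟩
    · have h1 := hsize i m hm
      simp only [inputSize, Word.size, Mem.word] at h1
      simp only [BExp.eval, NExp.eval, hv i m hm, decide_eq_false_iff_not]
      omega
    · have : i = B := by omega
      exact this ▸ hm
  | succ r ih =>
    intro i hi m hm
    obtain ⟨m₁, h₁, hI⟩ := hbody i (by omega) m hm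
    obtain ⟨m₂, ⟨t₂, ht₂, e₂⟩, hI₂⟩ := ih (i + 1) (by omega) _ hI
    obtain ⟨t₁, ht₁, e₁⟩ := h₁
    refine ⟨m₂, ⟨_, ?_, Exec.loop_next ?_ (e₁.seq (.assignN _ _ _)) e₂⟩, hI₂⟩
    · rw [Nat.succ_mul]; omega
    · have h1 := hsize i m hm
      simp only [inputSize, Word.size, Mem.word] at h1
      simp only [BExp.eval, NExp.eval, hv i m hm, decide_eq_true_iff]
      omega

/-! ### Terms with bounded iteration, and their compilation -/

/-- Terms with natural-number values over an input word `w` and an environment, a list of natural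
numbers in which variables are looked up by position. All iterations run `w.size` times. -/
inductive NTerm where
  | lit (c : ℕ)
  | var (j : ℕ)
  | add (a b : NTerm)
  | sub (a b : NTerm)
  | mul (a b : NTerm)
  | getN (i : NTerm)
  | isZero (i : NTerm)
  | bind (a b : NTerm)
  | call (θ : List ℕ) (a : NTerm)
  | ite (c a b : NTerm)
  | sum (a : NTerm)
  | iter (a b : NTerm)

/-- Terms with real values. -/
inductive RTerm where
  | lit (c : ℕ)
  | getR (i : NTerm)
  | add (a b : RTerm)
  | mul (a b : RTerm)
  | div (a b : RTerm)
  | bind (a : NTerm) (b : RTerm)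
  | call (θ : List ℕ) (a : RTerm)
  | ite (c : NTerm) (a b : RTerm)
  | prod (a : RTerm)

/-- Commands that emit a word. -/
inductive Cmd where
  | emitN (a : NTerm)
  | emitR (a : RTerm)
  | seq (a b : Cmd)
  | guard (c : NTerm) (a : Cmd)
  | loop (a : Cmd)

/-- The environment seen by a subterm that is called with the variables `θ`. -/
def pick (θ : List ℕ) (l : List ℕ) : List ℕ := θ.map fun j => l.getD j 0

noncomputable def NTerm.eval (w : Word) : NTerm → List ℕ → ℕ
  | .lit c, _ => c
  | .var j, l => l.getD j 0
  | .add a b, l => a.eval w l + b.eval w l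
  | .sub a b, l => a.eval w l - b.eval w l
  | .mul a b, l => a.eval w l * b.eval w l
  | .getN i, l => w.nats.getD (i.eval w l) 0
  | .isZero i, l => if w.reals.getD (i.eval w l) 0 = 0 then 1 else 0
  | .bind a b, l => b.eval w (a.eval w l :: l)
  | .call θ a, l => a.eval w (pick θ l)
  | .ite c a b, l => if c.eval w l = 0 then b.eval w l else a.eval w l
  | .sum a, l => ∑ i ∈ Finset.range w.size, a.eval w (i :: l)
  | .iter a b, l => Nat.rec (a.eval w l) (fun i y => b.eval w (y :: i :: l)) w.size

noncomputable def RTerm.eval (w : Word) : RTerm → List ℕ → ℝ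
  | .lit c, _ => c
  | .getR i, l => w.reals.getD (i.eval w l) 0
  | .add a b, l => a.eval w l + b.eval w l
  | .mul a b, l => a.eval w l * b.eval w l
  | .div a b, l => a.eval w l / b.eval w l
  | .bind a b, l => b.eval w (a.eval w l :: l)
  | .call θ a, l => a.eval w (pick θ l)
  | .ite c a b, l => if c.eval w l = 0 then b.eval w l else a.eval w l
  | .prod a, l => ∏ i ∈ Finset.range w.size, a.eval w (i :: l)

/-- The natural numbers emitted by a command. -/
noncomputable def Cmd.outN (w : Word) : Cmd → List ℕ → List ℕ
  | .emitN a, l => [a.eval w l]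
  | .emitR _, _ => []
  | .seq a b, l => a.outN w l ++ b.outN w l
  | .guard c a, l => if c.eval w l = 0 then [] else a.outN w l
  | .loop a, l => (List.range w.size).flatMap fun i => a.outN w (i :: l)

/-- The real numbers emitted by a command. -/
noncomputable def Cmd.outR (w : Word) : Cmd → List ℕ → List ℝ
  | .emitN _, _ => []
  | .emitR a, l => [a.eval w l]
  | .seq a b, l => a.outR w l ++ b.outR w l
  | .guard c a, l => if c.eval w l = 0 then [] else a.outR w l
  | .loop a, l => (List.range w.size).flatMap fun i => a.outR w (i :: l)

/-! ### Compilation of terms into machine code, with polynomial cost. -/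

/-- Code for a term. The list `Γ` has the registers of the variables, register `0` is zero, the
registers from `d` on are free, and the value is left in register `d`. -/
def NTerm.code : NTerm → List ℕ → ℕ → Stmt
  | .lit c, _, d => .assignN d (.lit c)
  | .var j, Γ, d => .assignN d (.reg (Γ.getD j 0))
  | .add a b, Γ, d =>
      .seq (a.code Γ d) (.seq (b.code Γ (d + 1)) (.assignN d (.add (.reg d) (.reg (d + 1)))))
  | .sub a b, Γ, d =>
      .seq (a.code Γ d) (.seq (b.code Γ (d + 1)) (.assignN d (.sub (.reg d) (.reg (d + 1)))))
  | .mul a b, Γ, d =>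
      .seq (a.code Γ d) (.seq (b.code Γ (d + 1)) (.assignN d (.mul (.reg d) (.reg (d + 1)))))
  | .getN i, Γ, d => .seq (i.code Γ d) (.assignN d (.get 0 (.reg d)))
  | .isZero i, Γ, d =>
      .seq (i.code Γ d) (.ite (.eqR (.get 0 (.reg d)) (.lit 0))
        (.assignN d (.lit 1)) (.assignN d (.lit 0)))
  | .bind a b, Γ, d =>
      .seq (a.code Γ d) (.seq (b.code (d :: Γ) (d + 1)) (.assignN d (.reg (d + 1))))
  | .call θ a, Γ, d => a.code (pick θ Γ) d
  | .ite c a b, Γ, d =>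
      .seq (c.code Γ d) (.ite (.eqN (.reg d) (.lit 0)) (b.code Γ d) (a.code Γ d))
  | .sum a, Γ, d =>
      .seq (.assignN d (.lit 0)) (.seq (.assignN (d + 1) (.lit 0))
        (forLoop (d + 1) (.seq (a.code ((d + 1) :: Γ) (d + 2))
          (.assignN d (.add (.reg d) (.reg (d + 2)))))))
  | .iter a b, Γ, d =>
      .seq (a.code Γ d) (.seq (.assignN (d + 1) (.lit 0))
        (forLoop (d + 1) (.seq (b.code (d :: (d + 1) :: Γ) (d + 2))
          (.assignN d (.reg (d + 2))))))

/-- Code for a real term; the value is left in the real register `r`. -/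
def RTerm.code : RTerm → List ℕ → ℕ → ℕ → Stmt
  | .lit c, _, _, r => .assignR r (.lit c)
  | .getR i, Γ, d, r => .seq (i.code Γ d) (.assignR r (.get 0 (.reg d)))
  | .add a b, Γ, d, r =>
      .seq (a.code Γ d r) (.seq (b.code Γ d (r + 1)) (.assignR r (.add (.reg r) (.reg (r + 1)))))
  | .mul a b, Γ, d, r =>
      .seq (a.code Γ d r) (.seq (b.code Γ d (r + 1)) (.assignR r (.mul (.reg r) (.reg (r + 1)))))
  | .div a b, Γ, d, r =>
      .seq (a.code Γ d r) (.seq (b.code Γ d (r + 1)) (.assignR r (.div (.reg r) (.reg (r + 1)))))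
  | .bind a b, Γ, d, r => .seq (a.code Γ d) (b.code (d :: Γ) (d + 1) r)
  | .call θ a, Γ, d, r => a.code (pick θ Γ) d r
  | .ite c a b, Γ, d, r =>
      .seq (c.code Γ d) (.ite (.eqN (.reg d) (.lit 0)) (b.code Γ d r) (a.code Γ d r))
  | .prod a, Γ, d, r =>
      .seq (.assignR r (.lit 1)) (.seq (.assignN d (.lit 0))
        (forLoop d (.seq (a.code (d :: Γ) (d + 1) (r + 1))
          (.assignR r (.mul (.reg r) (.reg (r + 1)))))))

/-- Code for a command; the word is appended to the arrays with name `2`. -/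
def Cmd.code : Cmd → List ℕ → ℕ → Stmt
  | .emitN a, Γ, d => .seq (a.code Γ d) (.pushN 2 (.reg d))
  | .emitR a, Γ, d => .seq (a.code Γ d 1) (.pushR 2 (.reg 1))
  | .seq a b, Γ, d => .seq (a.code Γ d) (b.code Γ d)
  | .guard c a, Γ, d => .seq (c.code Γ d) (.ite (.eqN (.reg d) (.lit 0)) .skip (a.code Γ d))
  | .loop a, Γ, d => .seq (.assignN d (.lit 0)) (forLoop d (a.code (d :: Γ) (d + 1)))

open Polynomial in
/-- A bound for the running time of the code, in terms of the size of the input. -/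
noncomputable def NTerm.cost : NTerm → ℕ[X]
  | .lit _ => 1
  | .var _ => 1
  | .add a b => a.cost + b.cost + 3
  | .sub a b => a.cost + b.cost + 3
  | .mul a b => a.cost + b.cost + 3
  | .getN i => i.cost + 2
  | .isZero i => i.cost + 3
  | .bind a b => a.cost + b.cost + 3
  | .call _ a => a.cost
  | .ite c a b => c.cost + a.cost + b.cost + 2
  | .sum a => X * (a.cost + 2 + 3) + 5
  | .iter a b => a.cost + X * (b.cost + 2 + 3) + 4

open Polynomial in
noncomputable def RTerm.cost : RTerm → ℕ[X]
  | .lit _ => 1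
  | .getR i => i.cost + 2
  | .add a b => a.cost + b.cost + 3
  | .mul a b => a.cost + b.cost + 3
  | .div a b => a.cost + b.cost + 3
  | .bind a b => a.cost + b.cost + 1
  | .call _ a => a.cost
  | .ite c a b => c.cost + a.cost + b.cost + 2
  | .prod a => X * (a.cost + 2 + 3) + 5

open Polynomial in
noncomputable def Cmd.cost : Cmd → ℕ[X]
  | .emitN a => a.cost + 2
  | .emitR a => a.cost + 2
  | .seq a b => a.cost + b.cost + 1
  | .guard c a => c.cost + a.cost + 3
  | .loop a => X * (a.cost + 3) + 3

/-- A variable outside the environment evaluates to `0` and is compiled to register `0`; `h0` makes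
the two defaults agree. -/
theorem pick_map (θ Γ : List ℕ) (g : ℕ → ℕ) (h0 : g 0 = 0) :
    pick θ (Γ.map g) = (pick θ Γ).map g := by
  simp only [pick, List.map_map]
  refine List.map_congr_left fun j _ => ?_
  simp only [Function.comp]
  rw [← List.getD_map (f := g), h0]

theorem lt_of_mem_pick {θ Γ : List ℕ} {d : ℕ} (hd : 0 < d) (hΓ : ∀ v ∈ Γ, v < d) :
    ∀ v ∈ pick θ Γ, v < d := by
  intro v hv
  obtain ⟨j, -, rfl⟩ := List.mem_map.1 hv
  by_cases hj : j < Γ.length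
  · rw [List.getD_eq_getElem _ _ hj]; exact hΓ _ (List.getElem_mem hj)
  · rw [List.getD_eq_default _ _ (by omega)]; exact hd

theorem map_congr_of_lt {Γ : List ℕ} {d : ℕ} (hΓ : ∀ v ∈ Γ, v < d) {g h : ℕ → ℕ}
    (hg : ∀ v < d, h v = g v) : Γ.map h = Γ.map g :=
  List.map_congr_left fun v hv => hg v (hΓ v hv)

theorem lt_succ_of_mem_cons {Γ : List ℕ} {d : ℕ} (hΓ : ∀ v ∈ Γ, v < d) :
    ∀ v ∈ d :: Γ, v < d + 1 := by
  intro v hv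
  rcases List.mem_cons.1 hv with rfl | h
  · omega
  · have := hΓ v h; omega

/-- Common part of `add`, `sub` and `mul`. The second operand starts from whatever the first one
left in the registers from `d` on, hence the quantifier over `g` in `hb`. -/
theorem NTerm.binary_exec {w : Word} {a b : NTerm} {Γ : List ℕ} {d : ℕ} {m : Mem} {ca cb : ℕ}
    {op : NExp → NExp → NExp} {f : ℕ → ℕ → ℕ}
    (hop : ∀ m x y, (op x y).eval m = f (x.eval m) (y.eval m))
    (hΓ : ∀ v ∈ Γ, v < d)
    (ha : ∃ g, ExecLe (a.code Γ d) m { m with nreg := g } ca ∧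
      (∀ v < d, g v = m.nreg v) ∧ g d = a.eval w (Γ.map m.nreg))
    (hb : ∀ g : ℕ → ℕ, (∀ v < d, g v = m.nreg v) →
      ∃ g', ExecLe (b.code Γ (d + 1)) { m with nreg := g } { m with nreg := g' } cb ∧
      (∀ v < d + 1, g' v = g v) ∧ g' (d + 1) = b.eval w (Γ.map g)) :
    ∃ g, ExecLe (.seq (a.code Γ d) (.seq (b.code Γ (d + 1))
        (.assignN d (op (.reg d) (.reg (d + 1)))))) m { m with nreg := g } (ca + cb + 3) ∧
      (∀ v < d, g v = m.nreg v) ∧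
        g d = f (a.eval w (Γ.map m.nreg)) (b.eval w (Γ.map m.nreg)) := by
  obtain ⟨g, e, hg, hgd⟩ := ha
  obtain ⟨g', e', hg', hgd'⟩ := hb g hg
  refine ⟨_, (e.seq (e'.seq (Exec.assignN _ _ _).le)).mono (by omega), ?_, ?_⟩
  · intro v hv
    dsimp only
    rw [Function.update_of_ne (by omega), hg' v (by omega), hg v hv]
  · simp only [Function.update_self, hop, NExp.eval]
    rw [hg' d (by omega), hgd, hgd', map_congr_of_lt hΓ hg]

/-- The registers below `d` hold the variables and the pending intermediate results; their
preservation is the frame condition that carries the induction. -/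
theorem NTerm.code_exec (w : Word) (e : NTerm) (Γ : List ℕ) (d : ℕ) (m : Mem) (hd : 0 < d)
    (hΓ : ∀ v ∈ Γ, v < d) (h0 : m.nreg 0 = 0) (hw : m.word 0 = w) :
    ∃ g, ExecLe (e.code Γ d) m { m with nreg := g } (e.cost.eval w.size) ∧
      (∀ v < d, g v = m.nreg v) ∧ g d = e.eval w (Γ.map m.nreg) := by
  have hw1 : m.narr 0 = w.nats := by rw [← hw]; rfl
  have hw2 : m.rarr 0 = w.reals := by rw [← hw]; rfl
  induction e generalizing Γ d m with
  | lit c =>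
    exact ⟨_, (Exec.assignN _ _ _).le.mono (by simp [cost]),
      fun v hv => Function.update_of_ne (by omega) _ _, by simp [NExp.eval, eval]⟩
  | var j =>
    refine ⟨_, (Exec.assignN _ _ _).le.mono (by simp [cost]),
      fun v hv => Function.update_of_ne (by omega) _ _, ?_⟩
    simp only [Function.update_self, NExp.eval, eval]
    rw [← List.getD_map (f := m.nreg), h0]
  | add a b iha ihb =>
    obtain ⟨g, e, h⟩ := NTerm.binary_exec (op := .add) (f := (· + ·)) (fun _ _ _ => rfl) hΓ
      (iha Γ d m hd hΓ h0 hw hw1 hw2) fun g hg => ihb Γ (d + 1) { m with nreg := g } (by omega)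
        (fun v hv => by have := hΓ v hv; omega) ((hg 0 hd).trans h0) hw hw1 hw2
    exact ⟨g, e.mono (by simp [cost]), h⟩
  | sub a b iha ihb =>
    obtain ⟨g, e, h⟩ := NTerm.binary_exec (op := .sub) (f := (· - ·)) (fun _ _ _ => rfl) hΓ
      (iha Γ d m hd hΓ h0 hw hw1 hw2) fun g hg => ihb Γ (d + 1) { m with nreg := g } (by omega)
        (fun v hv => by have := hΓ v hv; omega) ((hg 0 hd).trans h0) hw hw1 hw2
    exact ⟨g, e.mono (by simp [cost]), h⟩
  | mul a b iha ihb =>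
    obtain ⟨g, e, h⟩ := NTerm.binary_exec (op := .mul) (f := (· * ·)) (fun _ _ _ => rfl) hΓ
      (iha Γ d m hd hΓ h0 hw hw1 hw2) fun g hg => ihb Γ (d + 1) { m with nreg := g } (by omega)
        (fun v hv => by have := hΓ v hv; omega) ((hg 0 hd).trans h0) hw hw1 hw2
    exact ⟨g, e.mono (by simp [cost]), h⟩
  | getN i ih =>
    obtain ⟨g, e, hg, hgd⟩ := ih Γ d m hd hΓ h0 hw hw1 hw2
    refine ⟨_, (e.seq (Exec.assignN _ _ _).le).mono (by simp [cost]; omega), ?_, ?_⟩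
    · intro v hv
      dsimp only
      rw [Function.update_of_ne (by omega), hg v hv]
    · simp [NExp.eval, eval, hgd, hw1]
  | isZero i ih =>
    obtain ⟨g, e, hg, hgd⟩ := ih Γ d m hd hΓ h0 hw hw1 hw2
    refine ⟨Function.update g d (eval w (.isZero i) (Γ.map m.nreg)),
      (e.seq (ExecLe.ite (a := 1) ?_)).mono (by simp [cost]; omega), ?_, by simp⟩
    · simp only [BExp.eval, RExp.eval, NExp.eval, hgd, hw2, eval, Nat.cast_zero,
        decide_eq_true_iff]
      split_ifs
      · exact (Exec.assignN _ _ _).le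
      · exact (Exec.assignN _ _ _).le
    · intro v hv
      rw [Function.update_of_ne (by omega), hg v hv]
  | bind a b iha ihb =>
    obtain ⟨g, e, hg, hgd⟩ := iha Γ d m hd hΓ h0 hw hw1 hw2
    obtain ⟨g', e', hg', hgd'⟩ := ihb (d :: Γ) (d + 1) { m with nreg := g } (by omega)
      (lt_succ_of_mem_cons hΓ) ((hg 0 hd).trans h0) hw hw1 hw2
    dsimp only at hg' hgd'
    refine ⟨_, (e.seq (e'.seq (Exec.assignN _ _ _).le)).mono (by simp [cost]; omega), ?_, ?_⟩
    · intro v hv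
      dsimp only
      rw [Function.update_of_ne (by omega), hg' v (by omega), hg v hv]
    · simp only [Function.update_self, NExp.eval, eval]
      rw [hgd', List.map_cons, map_congr_of_lt hΓ hg, hgd]
  | call θ a ih =>
    obtain ⟨g, e, hg, hgd⟩ := ih (pick θ Γ) d m hd (lt_of_mem_pick hd hΓ) h0 hw hw1 hw2
    refine ⟨g, e, hg, ?_⟩
    rw [hgd, eval, pick_map _ _ _ h0]
  | ite c a b ihc iha ihb =>
    obtain ⟨g, e, hg, hgd⟩ := ihc Γ d m hd hΓ h0 hw hw1 hw2
    obtain ⟨g₁, e₁, hg₁, hgd₁⟩ := iha Γ d { m with nreg := g } hd hΓ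
      ((hg 0 hd).trans h0) hw hw1 hw2
    obtain ⟨g₂, e₂, hg₂, hgd₂⟩ := ihb Γ d { m with nreg := g } hd hΓ
      ((hg 0 hd).trans h0) hw hw1 hw2
    by_cases hc : c.eval w (Γ.map m.nreg) = 0
    · refine ⟨g₂, (e.seq (ExecLe.ite (a := b.cost.eval w.size) ?_)).mono
        (by simp [cost]; omega), fun v hv => (hg₂ v hv).trans (hg v hv), ?_⟩
      · simpa [BExp.eval, NExp.eval, hgd, hc] using e₂
      · rw [hgd₂, eval, if_pos hc, map_congr_of_lt hΓ hg]
    · refine ⟨g₁, (e.seq (ExecLe.ite (a := a.cost.eval w.size) ?_)).mono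
        (by simp [cost]; omega), fun v hv => (hg₁ v hv).trans (hg v hv), ?_⟩
      · simpa [BExp.eval, NExp.eval, hgd, hc] using e₁
      · rw [hgd₁, eval, if_neg hc, map_congr_of_lt hΓ hg]
  | sum a ih =>
    obtain ⟨m', e, g, rfl, hg, -, hgd⟩ := forLoop_exec (v := d + 1)
      (body := .seq (a.code ((d + 1) :: Γ) (d + 2)) (.assignN d (.add (.reg d) (.reg (d + 2)))))
      (B := w.size) (c := a.cost.eval w.size + 2)
      (fun i x => ∃ g : ℕ → ℕ, x = { m with nreg := g } ∧ (∀ v < d, g v = m.nreg v) ∧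
        g (d + 1) = i ∧ g d = ∑ i ∈ Finset.range i, a.eval w (i :: Γ.map m.nreg))
      (by rintro i _ ⟨g, rfl, -⟩; rw [← hw]; rfl) (by rintro i _ ⟨g, rfl, -, h, -⟩; exact h)
      (by
        rintro i - _ ⟨g, rfl, hg, hi, hs⟩
        obtain ⟨g', e', hg', hgd'⟩ := ih ((d + 1) :: Γ) (d + 2) { m with nreg := g } (by omega)
          (lt_succ_of_mem_cons fun v hv => by have := hΓ v hv; omega)
          ((hg 0 hd).trans h0) hw hw1 hw2
        dsimp only at hg' hgd'
        refine ⟨_, (e'.seq (Exec.assignN _ _ _).le).mono (by omega), _, rfl, ?_, ?_, ?_⟩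
        · intro v hv
          dsimp only
          rw [Function.update_of_ne (by omega), Function.update_of_ne (by omega),
            hg' v (by omega), hg v hv]
        · simp only [Function.update_self]
          rw [Function.update_of_ne (by omega), hg' _ (by omega), hi]
        · dsimp only
          rw [Function.update_of_ne (by omega), Function.update_self, Finset.sum_range_succ]
          simp only [NExp.eval]
          rw [hgd', hg' d (by omega), hs, List.map_cons, map_congr_of_lt hΓ hg, hi])
      { m with nreg := Function.update (Function.update m.nreg d 0) (d + 1) 0 }
      ⟨_, rfl, fun v hv => by
        rw [Function.update_of_ne (by omega), Function.update_of_ne (by omega)],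
        Function.update_self _ _ _, by simp⟩
    exact ⟨g, ((Exec.assignN _ _ _).le.seq ((Exec.assignN _ _ _).le.seq e)).mono
      (by simp [cost]; omega), hg, hgd⟩
  | iter a b iha ihb =>
    obtain ⟨g₀, e₀, hg₀, hgd₀⟩ := iha Γ d m hd hΓ h0 hw hw1 hw2
    obtain ⟨m', e, g, rfl, hg, -, hgd⟩ := forLoop_exec (v := d + 1)
      (body := .seq (b.code (d :: (d + 1) :: Γ) (d + 2)) (.assignN d (.reg (d + 2))))
      (B := w.size) (c := b.cost.eval w.size + 2)
      (fun i x => ∃ g : ℕ → ℕ, x = { m with nreg := g } ∧ (∀ v < d, g v = m.nreg v) ∧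
        g (d + 1) = i ∧ g d = Nat.rec (a.eval w (Γ.map m.nreg))
          (fun i y => b.eval w (y :: i :: Γ.map m.nreg)) i)
      (by rintro i _ ⟨g, rfl, -⟩; rw [← hw]; rfl) (by rintro i _ ⟨g, rfl, -, h, -⟩; exact h)
      (by
        rintro i - _ ⟨g, rfl, hg, hi, hs⟩
        obtain ⟨g', e', hg', hgd'⟩ := ihb (d :: (d + 1) :: Γ) (d + 2) { m with nreg := g }
          (by omega)
          (by
            intro v hv
            rcases List.mem_cons.1 hv with rfl | hv
            · omega
            · exact lt_succ_of_mem_cons (fun v hv => by have := hΓ v hv; omega) v hv)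
          ((hg 0 hd).trans h0) hw hw1 hw2
        dsimp only at hg' hgd'
        refine ⟨_, (e'.seq (Exec.assignN _ _ _).le).mono (by omega), _, rfl, ?_, ?_, ?_⟩
        · intro v hv
          dsimp only
          rw [Function.update_of_ne (by omega), Function.update_of_ne (by omega),
            hg' v (by omega), hg v hv]
        · simp only [Function.update_self]
          rw [Function.update_of_ne (by omega), hg' _ (by omega), hi]
        · dsimp only
          rw [Function.update_of_ne (by omega), Function.update_self]
          simp only [NExp.eval]
          rw [hgd', List.map_cons, List.map_cons, map_congr_of_lt hΓ hg, hi, hs])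
      { m with nreg := Function.update g₀ (d + 1) 0 }
      ⟨_, rfl, fun v hv => by rw [Function.update_of_ne (by omega), hg₀ v hv],
        Function.update_self _ _ _, by rw [Function.update_of_ne (by omega), hgd₀]; rfl⟩
    exact ⟨g, (e₀.seq ((Exec.assignN _ _ _).le.seq e)).mono (by simp [cost]; omega), hg, hgd⟩

theorem RTerm.binary_exec {w : Word} {a b : RTerm} {Γ : List ℕ} {d r : ℕ} {m : Mem} {ca cb : ℕ}
    {op : RExp → RExp → RExp} {f : ℝ → ℝ → ℝ}
    (hop : ∀ m x y, (op x y).eval m = f (x.eval m) (y.eval m))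
    (hΓ : ∀ v ∈ Γ, v < d)
    (ha : ∃ g h, ExecLe (a.code Γ d r) m { m with nreg := g, rreg := h } ca ∧
      (∀ v < d, g v = m.nreg v) ∧ (∀ v < r, h v = m.rreg v) ∧ h r = a.eval w (Γ.map m.nreg))
    (hb : ∀ (g : ℕ → ℕ) (h : ℕ → ℝ), (∀ v < d, g v = m.nreg v) →
      ∃ g' h', ExecLe (b.code Γ d (r + 1)) { m with nreg := g, rreg := h }
          { m with nreg := g', rreg := h' } cb ∧
        (∀ v < d, g' v = g v) ∧ (∀ v < r + 1, h' v = h v) ∧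
        h' (r + 1) = b.eval w (Γ.map g)) :
    ∃ g h, ExecLe (.seq (a.code Γ d r) (.seq (b.code Γ d (r + 1))
        (.assignR r (op (.reg r) (.reg (r + 1)))))) m { m with nreg := g, rreg := h }
          (ca + cb + 3) ∧
      (∀ v < d, g v = m.nreg v) ∧ (∀ v < r, h v = m.rreg v) ∧
        h r = f (a.eval w (Γ.map m.nreg)) (b.eval w (Γ.map m.nreg)) := by
  obtain ⟨g, h, e, hg, hh, hr⟩ := ha
  obtain ⟨g', h', e', hg', hh', hr'⟩ := hb g h hg
  refine ⟨_, _, (e.seq (e'.seq (Exec.assignR _ _ _).le)).mono (by omega), ?_, ?_, ?_⟩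
  · intro v hv
    exact (hg' v hv).trans (hg v hv)
  · intro v hv
    dsimp only
    rw [Function.update_of_ne (by omega), hh' v (by omega), hh v hv]
  · simp only [Function.update_self, hop, RExp.eval]
    rw [hh' r (by omega), hr, hr', map_congr_of_lt hΓ hg]

theorem RTerm.code_exec (w : Word) (e : RTerm) (Γ : List ℕ) (d r : ℕ) (m : Mem) (hd : 0 < d)
    (hΓ : ∀ v ∈ Γ, v < d) (h0 : m.nreg 0 = 0) (hw : m.word 0 = w) :
    ∃ g h, ExecLe (e.code Γ d r) m { m with nreg := g, rreg := h } (e.cost.eval w.size) ∧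
      (∀ v < d, g v = m.nreg v) ∧ (∀ v < r, h v = m.rreg v) ∧
      h r = e.eval w (Γ.map m.nreg) := by
  have hw2 : m.rarr 0 = w.reals := by rw [← hw]; rfl
  induction e generalizing Γ d r m with
  | lit c =>
    exact ⟨m.nreg, _, (Exec.assignR _ _ _).le.mono (by simp [cost]), fun _ _ => rfl,
      fun v hv => Function.update_of_ne (by omega) _ _, by simp [RExp.eval, eval]⟩
  | getR i =>
    obtain ⟨g, e, hg, hgd⟩ := i.code_exec w Γ d m hd hΓ h0 hw
    exact ⟨g, _, (e.seq (Exec.assignR _ _ _).le).mono (by simp [cost]; omega), hg,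
      fun v hv => Function.update_of_ne (by omega) _ _,
      by simp [RExp.eval, NExp.eval, eval, hgd, hw2]⟩
  | add a b iha ihb =>
    obtain ⟨g, h, e, h⟩ := RTerm.binary_exec (op := .add) (f := (· + ·)) (fun _ _ _ => rfl) hΓ
      (iha Γ d r m hd hΓ h0 hw hw2) fun g h hg => ihb Γ d (r + 1)
        { m with nreg := g, rreg := h } hd hΓ ((hg 0 hd).trans h0) hw hw2
    exact ⟨g, _, e.mono (by simp [cost]), h⟩
  | mul a b iha ihb =>
    obtain ⟨g, h, e, h⟩ := RTerm.binary_exec (op := .mul) (f := (· * ·)) (fun _ _ _ => rfl) hΓ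
      (iha Γ d r m hd hΓ h0 hw hw2) fun g h hg => ihb Γ d (r + 1)
        { m with nreg := g, rreg := h } hd hΓ ((hg 0 hd).trans h0) hw hw2
    exact ⟨g, _, e.mono (by simp [cost]), h⟩
  | div a b iha ihb =>
    obtain ⟨g, h, e, h⟩ := RTerm.binary_exec (op := .div) (f := (· / ·)) (fun _ _ _ => rfl) hΓ
      (iha Γ d r m hd hΓ h0 hw hw2) fun g h hg => ihb Γ d (r + 1)
        { m with nreg := g, rreg := h } hd hΓ ((hg 0 hd).trans h0) hw hw2
    exact ⟨g, _, e.mono (by simp [cost]), h⟩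
  | bind a b ih =>
    obtain ⟨g, e, hg, hgd⟩ := a.code_exec w Γ d m hd hΓ h0 hw
    obtain ⟨g', h', e', hg', hh', hr'⟩ := ih (d :: Γ) (d + 1) r { m with nreg := g } (by omega)
      (lt_succ_of_mem_cons hΓ) ((hg 0 hd).trans h0) hw hw2
    dsimp only at hg' hr'
    refine ⟨g', h', (e.seq e').mono (by simp [cost]; omega), ?_, hh', ?_⟩
    · intro v hv
      rw [hg' v (by omega), hg v hv]
    · rw [hr', eval, List.map_cons, map_congr_of_lt hΓ hg, hgd]
  | call θ a ih =>
    obtain ⟨g, h, e, hg, hh, hr⟩ := ih (pick θ Γ) d r m hd (lt_of_mem_pick hd hΓ) h0 hw hw2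
    refine ⟨g, h, e, hg, hh, ?_⟩
    rw [hr, eval, pick_map _ _ _ h0]
  | ite c a b iha ihb =>
    obtain ⟨g, e, hg, hgd⟩ := c.code_exec w Γ d m hd hΓ h0 hw
    obtain ⟨g₁, h₁, e₁, hg₁, hh₁, hr₁⟩ := iha Γ d r { m with nreg := g } hd hΓ
      ((hg 0 hd).trans h0) hw hw2
    obtain ⟨g₂, h₂, e₂, hg₂, hh₂, hr₂⟩ := ihb Γ d r { m with nreg := g } hd hΓ
      ((hg 0 hd).trans h0) hw hw2
    by_cases hc : c.eval w (Γ.map m.nreg) = 0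
    · refine ⟨g₂, h₂, (e.seq (ExecLe.ite (a := b.cost.eval w.size) ?_)).mono
        (by simp [cost]; omega), fun v hv => (hg₂ v hv).trans (hg v hv), hh₂, ?_⟩
      · simpa [BExp.eval, NExp.eval, hgd, hc] using e₂
      · rw [hr₂, eval, if_pos hc, map_congr_of_lt hΓ hg]
    · refine ⟨g₁, h₁, (e.seq (ExecLe.ite (a := a.cost.eval w.size) ?_)).mono
        (by simp [cost]; omega), fun v hv => (hg₁ v hv).trans (hg v hv), hh₁, ?_⟩
      · simpa [BExp.eval, NExp.eval, hgd, hc] using e₁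
      · rw [hr₁, eval, if_neg hc, map_congr_of_lt hΓ hg]
  | prod a ih =>
    obtain ⟨m', e, g, h, rfl, hg, -, hh, hr⟩ := forLoop_exec (v := d)
      (body := .seq (a.code (d :: Γ) (d + 1) (r + 1)) (.assignR r (.mul (.reg r) (.reg (r + 1)))))
      (B := w.size) (c := a.cost.eval w.size + 2)
      (fun i x => ∃ (g : ℕ → ℕ) (h : ℕ → ℝ), x = { m with nreg := g, rreg := h } ∧
        (∀ v < d, g v = m.nreg v) ∧ g d = i ∧ (∀ v < r, h v = m.rreg v) ∧
        h r = ∏ i ∈ Finset.range i, a.eval w (i :: Γ.map m.nreg))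
      (by rintro i _ ⟨g, h, rfl, -⟩; rw [← hw]; rfl)
      (by rintro i _ ⟨g, h, rfl, -, h, -⟩; exact h)
      (by
        rintro i - _ ⟨g, h, rfl, hg, hi, hh, hs⟩
        obtain ⟨g', h', e', hg', hh', hr'⟩ := ih (d :: Γ) (d + 1) (r + 1)
          { m with nreg := g, rreg := h } (by omega) (lt_succ_of_mem_cons hΓ)
          ((hg 0 hd).trans h0) hw hw2
        dsimp only at hg' hh' hr'
        refine ⟨_, (e'.seq (Exec.assignR _ _ _).le).mono (by omega), _, _, rfl, ?_, ?_, ?_, ?_⟩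
        · intro v hv
          dsimp only
          rw [Function.update_of_ne (by omega), hg' v (by omega), hg v hv]
        · dsimp only
          rw [Function.update_self, hg' _ (by omega), hi]
        · intro v hv
          dsimp only
          rw [Function.update_of_ne (by omega), hh' v (by omega), hh v hv]
        · dsimp only
          rw [Function.update_self, Finset.prod_range_succ]
          simp only [RExp.eval]
          rw [hr', hh' r (by omega), hs, List.map_cons, map_congr_of_lt hΓ hg, hi])
      { m with nreg := Function.update m.nreg d 0, rreg := Function.update m.rreg r 1 }
      ⟨_, _, rfl, fun v hv => Function.update_of_ne (by omega) _ _,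
        Function.update_self _ _ _, fun v hv => Function.update_of_ne (by omega) _ _, by simp⟩
    have e₀ : ExecLe (RTerm.code (.prod a) Γ d r) m { m with nreg := g, rreg := h } _ :=
      (Exec.assignR _ _ _).le.seq ((Exec.assignN _ _ _).le.seq
        (by simpa [RExp.eval, NExp.eval] using e))
    exact ⟨g, h, e₀.mono (by simp [cost]; omega), hg, hh, hr⟩

/-- Output goes to the arrays `2`, so the input stays readable and keeps its size. Real terms are
evaluated from real register `1` on, so the tolerance survives in real register `0`. -/
theorem Cmd.code_exec (w : Word) (e : Cmd) (Γ : List ℕ) (d : ℕ) (m : Mem) (hd : 0 < d)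
    (hΓ : ∀ v ∈ Γ, v < d) (h0 : m.nreg 0 = 0) (hw : m.word 0 = w) :
    ∃ g h, ExecLe (e.code Γ d) m
      ⟨g, h, Function.update m.narr 2 (m.narr 2 ++ e.outN w (Γ.map m.nreg)),
        Function.update m.rarr 2 (m.rarr 2 ++ e.outR w (Γ.map m.nreg))⟩ (e.cost.eval w.size) ∧
      (∀ v < d, g v = m.nreg v) ∧ h 0 = m.rreg 0 := by
  induction e generalizing Γ d m with
  | emitN a =>
    obtain ⟨g, e, hg, hgd⟩ := a.code_exec w Γ d m hd hΓ h0 hw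
    have e' := e.seq (Exec.pushN _ 2 (.reg d)).le
    refine ⟨g, m.rreg, ExecLe.mono (a := 1 + (a.cost.eval w.size + 1)) ?_
      (by simp [cost]; omega), hg, rfl⟩
    simpa [NExp.eval, hgd, outN, outR, code] using e'
  | emitR a =>
    obtain ⟨g, h, e, hg, hh, hr⟩ := a.code_exec w Γ d 1 m hd hΓ h0 hw
    have e' := e.seq (Exec.pushR _ 2 (.reg 1)).le
    refine ⟨g, h, ExecLe.mono (a := 1 + (a.cost.eval w.size + 1)) ?_
      (by simp [cost]; omega), hg, hh 0 (by omega)⟩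
    simpa [RExp.eval, hr, outN, outR, code] using e'
  | seq a b iha ihb =>
    obtain ⟨g, h, e, hg, hh⟩ := iha Γ d m hd hΓ h0 hw
    obtain ⟨g', h', e', hg', hh'⟩ := ihb Γ d
      ⟨g, h, Function.update m.narr 2 (m.narr 2 ++ a.outN w (Γ.map m.nreg)),
        Function.update m.rarr 2 (m.rarr 2 ++ a.outR w (Γ.map m.nreg))⟩
      hd hΓ ((hg 0 hd).trans h0) (by rw [← hw]; rfl)
    have e'' := e.seq e'
    refine ⟨g', h', ExecLe.mono (a := 1 + (a.cost.eval w.size + b.cost.eval w.size)) ?_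
      (by simp [cost]; omega), fun v hv => (hg' v hv).trans (hg v hv), hh'.trans hh⟩
    simpa [outN, outR, code, map_congr_of_lt hΓ hg] using e''
  | guard c a ih =>
    obtain ⟨g, e, hg, hgd⟩ := c.code_exec w Γ d m hd hΓ h0 hw
    by_cases hc : c.eval w (Γ.map m.nreg) = 0
    · refine ⟨g, m.rreg, (e.seq (ExecLe.ite (a := 1) ?_)).mono
        (by simp [cost]; omega), hg, rfl⟩
      simpa [BExp.eval, NExp.eval, hgd, hc, outN, outR] using (Exec.skip _).le
    · obtain ⟨g', h', e', hg', hh'⟩ := ih Γ d { m with nreg := g } hd hΓ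
        ((hg 0 hd).trans h0) hw
      refine ⟨g', h', (e.seq (ExecLe.ite (a := a.cost.eval w.size) ?_)).mono
        (by simp [cost]; omega), fun v hv => (hg' v hv).trans (hg v hv), hh'⟩
      simpa [BExp.eval, NExp.eval, hgd, hc, outN, outR, map_congr_of_lt hΓ hg] using e'
  | loop a ih =>
    obtain ⟨m', e, g, h, rfl, hg, -, hh⟩ := forLoop_exec (v := d)
      (body := a.code (d :: Γ) (d + 1))
      (B := w.size) (c := a.cost.eval w.size)
      (fun i x => ∃ (g : ℕ → ℕ) (h : ℕ → ℝ), x = ⟨g, h,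
          Function.update m.narr 2 (m.narr 2 ++
            (List.range i).flatMap fun i => a.outN w (i :: Γ.map m.nreg)),
          Function.update m.rarr 2 (m.rarr 2 ++
            (List.range i).flatMap fun i => a.outR w (i :: Γ.map m.nreg))⟩ ∧
        (∀ v < d, g v = m.nreg v) ∧ g d = i ∧ h 0 = m.rreg 0)
      (by rintro i _ ⟨g, h, rfl, -⟩; rw [← hw]; rfl)
      (by rintro i _ ⟨g, h, rfl, -, h, -⟩; exact h)
      (by
        rintro i - _ ⟨g, h, rfl, hg, hi, hh⟩
        obtain ⟨g', h', e', hg', hh'⟩ := ih (d :: Γ) (d + 1) ⟨g, h,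
            Function.update m.narr 2 (m.narr 2 ++
              (List.range i).flatMap fun i => a.outN w (i :: Γ.map m.nreg)),
            Function.update m.rarr 2 (m.rarr 2 ++
              (List.range i).flatMap fun i => a.outR w (i :: Γ.map m.nreg))⟩ (by omega)
          (lt_succ_of_mem_cons hΓ) ((hg 0 hd).trans h0) (by rw [← hw]; rfl)
        dsimp only at hg' hh'
        refine ⟨_, e', Function.update g' d (g' d + 1), h', ?_, ?_, ?_, hh'.trans hh⟩
        · simp [List.range_succ, map_congr_of_lt hΓ hg, hi]
        · intro v hv
          rw [Function.update_of_ne (by omega), hg' v (by omega), hg v hv]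
        · rw [Function.update_self, hg' _ (by omega), hi])
      { m with nreg := Function.update m.nreg d 0 }
      ⟨Function.update m.nreg d 0, m.rreg, by simp,
        fun v hv => Function.update_of_ne (by omega) _ _, Function.update_self _ _ _, rfl⟩
    exact ⟨g, h, ((Exec.assignN _ _ _).le.seq e).mono (by simp [cost]; omega), hg, hh⟩

/-! ### Reductions that make a single oracle call -/

/-- Emit a word, call the oracle on it with the given tolerance, and return the answer. -/
def Cmd.reduction (C : Cmd) : Stmt := .seq (C.code [] 1) (.query 2 1 (.reg 0))

/-- If a command translates instances so that approximate solutions are preserved, then the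
problems are reducible. -/
theorem MaxProblem.APTReducible.of_cmd {P Q : MaxProblem} (C : Cmd)
    (h : ∀ x : P.Inst, ∃ z : Q.Inst,
      Q.encInst z = ⟨C.outN (P.encInst x) [], C.outR (P.encInst x) []⟩ ∧
      ∀ ε : ℝ, 0 < ε → ε < 1 → ∀ y : Q.Sol z, Q.IsApprox ((2 : ℝ) ^ ε) z y →
        ∃ y' : P.Sol x, P.encSol x y' = Q.encSol z y ∧ P.IsApprox ((2 : ℝ) ^ ε) x y') :
    P.APTReducible Q := by
  -- The oracle is called with `ε` itself, so `1 / ε` bounds the inverse tolerance. The summand `2`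
  -- counts the unfolding of the outer `seq` and the query.
  refine ⟨C.reduction, MvPolynomial.X 1,
    Polynomial.eval₂ (Nat.castRingHom _) (MvPolynomial.X 0) C.cost + 2, ?_⟩
  intro M hM x ε hε hε1
  obtain ⟨z, hz, happ⟩ := h x
  set w := P.encInst x with hwdef
  set m₀ : Mem := (initCfg C.reduction w ε).mem with hm₀
  obtain ⟨g, r, ⟨T, hT, e⟩, hg, hr⟩ := C.code_exec w [] 1 m₀ one_pos (by simp) rfl
    (by simp [hm₀, initCfg, Mem.load, Mem.word])
  set m₁ : Mem := ⟨g, r, Function.update m₀.narr 2 (m₀.narr 2 ++ C.outN w (List.map m₀.nreg [])),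
    Function.update m₀.rarr 2 (m₀.rarr 2 ++ C.outR w (List.map m₀.nreg []))⟩ with hm₁
  have hword : m₁.word 2 = Q.encInst z := by
    rw [hz]; simp [hm₁, Mem.word, hm₀, initCfg, Mem.load]
  have htol : RExp.eval m₁ (.reg 0) = ε := by
    simp [RExp.eval, hm₁, hr, hm₀, initCfg, Mem.load]
  have hinit : initCfg C.reduction w ε = ⟨[.seq (C.code [] 1) (.query 2 1 (.reg 0))], m₀⟩ := rfl
  -- The query is the last statement: after it the machine has halted and extra steps change
  -- nothing.
  have hquery : ∀ u, run M (1 + u) ⟨[.query 2 1 (.reg 0)], m₁⟩ =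
      (M (Q.encInst z) ε).map fun v => ⟨[], m₁.load 1 v⟩ := by
    intro u
    rw [run_succ]
    simp only [step, hword, htol]
    have : run M u ∘ (fun v => (⟨[], m₁.load 1 v⟩ : Cfg)) =
        PMF.pure ∘ fun v => (⟨[], m₁.load 1 v⟩ : Cfg) := by
      funext v; exact run_halted M u _
    rw [PMF.bind_map, this, ← PMF.bind_map, PMF.bind_pure]
  constructor
  · intro t c hc w' δ hask
    -- The emission of the word asks nothing, so a configuration that asks lies beyond it.
    have key : ∃ u, c ∈ (run M u ⟨[.query 2 1 (.reg 0)], m₁⟩).support := by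
      rw [hinit] at hc
      cases t with
      | zero =>
        simp only [run, PMF.support_pure, Set.mem_singleton_iff] at hc
        subst hc
        simp [Cfg.Asks] at hask
      | succ t =>
        simp only [run, step, PMF.pure_bind] at hc
        rcases e.not_asks M _ _ c hc with hn | hn
        · exact absurd hask (hn _ _)
        · exact hn
    obtain ⟨u, hu⟩ := key
    cases u with
    | zero =>
      simp only [run, PMF.support_pure, Set.mem_singleton_iff] at hu
      subst hu
      obtain ⟨q, a, e', k, h1, h2, h3⟩ := hask
      simp only [List.cons.injEq, Stmt.query.injEq] at h1
      obtain ⟨⟨rfl, rfl, rfl⟩, -⟩ := h1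
      rw [hword] at h2
      rw [htol] at h3
      subst h3
      refine ⟨⟨z, h2⟩, hε, hε1, ?_⟩
      simp [MaxProblem.bound]
    | succ u =>
      rw [Nat.add_comm, hquery] at hu
      simp only [PMF.support_map, Set.mem_image] at hu
      obtain ⟨v, -, rfl⟩ := hu
      simp [Cfg.Asks] at hask
  · have hrun : run M (1 + (T + (1 + 0))) (initCfg C.reduction w ε) =
        (M (Q.encInst z) ε).map fun v => ⟨[], m₁.load 1 v⟩ := by
      rw [hinit, run_succ]
      simp only [step, PMF.pure_bind]
      rw [e.run_eq, hquery]
    refine ⟨1 + (T + (1 + 0)), ?_, ?_, ?_⟩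
    · have h1 : MvPolynomial.eval ![(P.size x : ℝ), 1 / ε]
          (Polynomial.eval₂ (Nat.castRingHom _) (MvPolynomial.X 0) C.cost) =
          ((C.cost.eval w.size : ℕ) : ℝ) := by
        rw [Polynomial.hom_eval₂]
        simp only [MvPolynomial.eval_X, Matrix.cons_val_zero]
        rw [Subsingleton.elim ((MvPolynomial.eval ![(P.size x : ℝ), 1 / ε]).comp
          (Nat.castRingHom _)) (Nat.castRingHom ℝ)]
        exact (Polynomial.hom_eval₂ C.cost (RingHom.id ℕ) (Nat.castRingHom ℝ) _).symm
      simp only [MaxProblem.bound, map_add, h1, map_ofNat]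
      have h2 : ((T : ℕ) : ℝ) ≤ ((C.cost.eval w.size : ℕ) : ℝ) := by exact_mod_cast hT
      push_cast
      linarith
    · intro c hc
      rw [hrun] at hc
      simp only [PMF.support_map, Set.mem_image] at hc
      obtain ⟨v, -, rfl⟩ := hc
      rfl
    · rw [hrun, PMF.map_comp]
      have hid : (Cfg.output ∘ fun v => (⟨[], m₁.load 1 v⟩ : Cfg)) = id := by
        funext v
        simp [Cfg.output, Mem.word, Mem.load]
      rw [hid, PMF.map_id]
      refine le_trans (hM z ε hε hε1) (MeasureTheory.OuterMeasure.mono _ ?_)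
      rintro v ⟨y, rfl, hy⟩
      exact happ ε hε hε1 y hy

/-! ### The structure of products of unary constraints and implications -/

section Structure

variable {k : ℕ} (f : (Fin k → Bool) → ℝ≥0)

/-- On the support of `f`, the variable `p` implies the variable `q`. -/
def Implies (p q : Fin k) : Prop := ∀ x, f x ≠ 0 → x p = true → x q = true

/-- The variable `p` takes the value `b` on the support of `f`. -/
def Takes (p : Fin k) (b : Bool) : Prop := ∃ x, f x ≠ 0 ∧ x p = b

/-- The variable `p` is not constant on the support, and it is the first one in its class of
equivalent variables. -/
def IsRep (p : Fin k) : Prop :=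
  Takes f p true ∧ Takes f p false ∧ ∀ q < p, ¬ (Implies f p q ∧ Implies f q p)

/-- A pair of incomparable representatives, in increasing order. -/
def Incomp (p q : Fin k) : Prop :=
  p < q ∧ IsRep f p ∧ IsRep f q ∧ ¬ Implies f p q ∧ ¬ Implies f q p

open Classical in
/-- The indicator of the consequences of `p` and of `q`, from which the variables that imply `p`
(if `a`) and those that imply `q` (if `b`) are removed. -/
noncomputable def consequences (p q : Fin k) (a b : Bool) : Fin k → Bool := fun j =>
  decide ((Implies f p j ∨ Implies f q j) ∧ ¬ (a = true ∧ Implies f j p) ∧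
    ¬ (b = true ∧ Implies f j q))

/-- The weight of the representative `p`. -/
noncomputable def weight (p : Fin k) : ℝ≥0 :=
  f (consequences f p p false false) / f (consequences f p p true true)

/-- The interaction of an incomparable pair. -/
noncomputable def interaction (p q : Fin k) : ℝ≥0 :=
  f (consequences f p q false false) * f (consequences f p q true true) /
    (f (consequences f p q true false) * f (consequences f p q false true))

variable {f}

theorem Implies.refl (p : Fin k) : Implies f p p := fun _ _ h => h

theorem Implies.trans {p q r : Fin k} (h : Implies f p q) (h' : Implies f q r) :
    Implies f p r := fun x hx hp => h' x hx (h x hx hp)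

theorem consequences_eq_true {p q j : Fin k} {a b : Bool} :
    consequences f p q a b j = true ↔ (Implies f p j ∨ Implies f q j) ∧
      ¬ (a = true ∧ Implies f j p) ∧ ¬ (b = true ∧ Implies f j q) := by
  simp [consequences]

/-- For a product of unary constraints and implications, the support consists of the points that
satisfy its binary and unary consequences. -/
theorem ne_zero_of_closed {L : List (ImFactor k)}
    (hL : ∀ x, f x = (L.map (ImFactor.eval x)).prod) {x : Fin k → Bool}
    (h₁ : ∀ p q, Implies f p q → x p = true → x q = true) (h₂ : ∀ p, Takes f p (x p)) :
    f x ≠ 0 := by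
  rw [hL]
  intro h0
  obtain ⟨F, hF, hz⟩ := List.mem_map.1 (List.prod_eq_zero_iff.1 h0)
  -- The factor `F` vanishes at `x` but nowhere on the support. A unary `F` then contradicts `h₂`;
  -- an implication can vanish only for `lam = 0`, is then valid on the support, and contradicts
  -- `h₁`.
  have hfac : ∀ y, f y ≠ 0 → F.eval y ≠ 0 := by
    intro y hy h
    refine hy ?_
    rw [hL]
    exact List.prod_eq_zero (List.mem_map.2 ⟨F, hF, h⟩)
  cases F with
  | unary i u =>
    obtain ⟨y, hy, hyx⟩ := h₂ i
    have := hfac y hy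
    simp only [ImFactor.eval] at this hz
    rw [hyx] at this
    exact this hz
  | imp i j lam hlam =>
    simp only [ImFactor.eval] at hz hfac
    split_ifs at hz with hc
    · have himp : Implies f i j := by
        intro y hy hi
        by_contra hj
        have := hfac y hy
        rw [if_pos ⟨hi, by simpa using hj⟩] at this
        exact this hz
      have := h₁ i j himp hc.1
      simp [hc.2] at this
    · exact one_ne_zero hz

theorem Takes.of_implies {p q : Fin k} (h : Takes f p true) (hi : Implies f p q) :
    Takes f q true :=
  let ⟨x, hx, hp⟩ := h; ⟨x, hx, hi x hx hp⟩

theorem implies_of_not_takes {p : Fin k} (h : ¬ Takes f p false) (q : Fin k) :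
    Implies f q p := by
  intro x hx _
  by_contra hp
  exact h ⟨x, hx, by simpa using hp⟩

theorem implies_of_not_takes_true {p : Fin k} (h : ¬ Takes f p true) (q : Fin k) :
    Implies f p q := fun x hx hp => absurd ⟨x, hx, hp⟩ h

/-- Removing a down-set from an up-set of the implication order leaves an up-set. It contains every
variable that is never false, since such a variable implies no representative, and no variable that
is never true, since `p` and `q` are sometimes true. So `ne_zero_of_closed` applies. -/
theorem consequences_ne_zero {L : List (ImFactor k)}
    (hL : ∀ x, f x = (L.map (ImFactor.eval x)).prod) {p q : Fin k} (hp : IsRep f p)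
    (hq : IsRep f q) (a b : Bool) : f (consequences f p q a b) ≠ 0 := by
  refine ne_zero_of_closed hL ?_ ?_
  · intro i j hij hi
    rw [consequences_eq_true] at hi ⊢
    refine ⟨hi.1.imp (·.trans hij) (·.trans hij), fun h => hi.2.1 ⟨h.1, hij.trans h.2⟩,
      fun h => hi.2.2 ⟨h.1, hij.trans h.2⟩⟩
  · intro i
    cases h : consequences f p q a b i with
    | true =>
      rw [consequences_eq_true] at h
      rcases h.1 with h | h
      · exact hp.1.of_implies h
      · exact hq.1.of_implies h
    | false =>
      by_contra hi
      have hback : ∀ r, IsRep f r → ¬ Implies f i r := by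
        rintro r ⟨-, ⟨x, hx, hr⟩, -⟩ hir
        have : x i = true := by
          by_contra hxi
          exact hi ⟨x, hx, by simpa using hxi⟩
        simp [hir x hx this] at hr
      have : consequences f p q a b i = true :=
        consequences_eq_true.2 ⟨.inl (implies_of_not_takes hi p), fun h => hback p hp h.2,
          fun h => hback q hq h.2⟩
      simp [this] at h

theorem IsRep.eq {p q : Fin k} (hp : IsRep f p) (hq : IsRep f q) (h : Implies f p q)
    (h' : Implies f q p) : p = q := by
  rcases lt_trichotomy p q with hlt | rfl | hlt
  · exact absurd ⟨h', h⟩ (hq.2.2 p hlt)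
  · rfl
  · exact absurd ⟨h, h'⟩ (hp.2.2 q hlt)

theorem exists_isRep {p : Fin k} (h : Takes f p true) (h' : Takes f p false) :
    ∃ r, IsRep f r ∧ Implies f p r ∧ Implies f r p := by
  classical
  obtain ⟨r, ⟨hr₁, hr₂⟩, hmin⟩ := WellFounded.has_min (wellFounded_lt (α := Fin k))
    {r | Implies f p r ∧ Implies f r p} ⟨p, .refl p, .refl p⟩
  refine ⟨r, ⟨h.of_implies hr₁, ?_, ?_⟩, hr₁, hr₂⟩
  · obtain ⟨x, hx, hp⟩ := h'
    refine ⟨x, hx, ?_⟩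
    by_contra hr
    simp [hr₂ x hx (by simpa using hr)] at hp
  · rintro q hq ⟨h₁, h₂⟩
    exact hmin q ⟨hr₁.trans h₁, h₂.trans hr₂⟩ hq

/-! ### The canonical form of a constraint on its support. -/

open Classical in
/-- On the support, `G` is a product of weights of representatives and of interactions, which are
at least `1`, of incomparable pairs. -/
def Canonical (f G : (Fin k → Bool) → ℝ≥0) : Prop :=
  ∃ (c : ℝ≥0) (a : Fin k → ℝ≥0) (b : Fin k → Fin k → ℝ≥0), c ≠ 0 ∧ (∀ p, a p ≠ 0) ∧
    (∀ p, ¬ IsRep f p → a p = 1) ∧ (∀ p q, 1 ≤ b p q) ∧ (∀ p q, ¬ Incomp f p q → b p q = 1) ∧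
    ∀ x, f x ≠ 0 → G x = c * (∏ p, if x p = true then a p else 1) *
      ∏ p, ∏ q, if x p = true ∧ x q = true then b p q else 1

theorem Canonical.congr {G H : (Fin k → Bool) → ℝ≥0} (h : Canonical f G)
    (hGH : ∀ x, f x ≠ 0 → H x = G x) : Canonical f H := by
  obtain ⟨c, a, b, hc, ha, ha', hb, hb', hG⟩ := h
  exact ⟨c, a, b, hc, ha, ha', hb, hb', fun x hx => (hGH x hx).trans (hG x hx)⟩

/-- Here `f` serves only to fix the support; this allows a factorization of `f` to be treated one
factor at a time. -/
theorem Canonical.mul {G H : (Fin k → Bool) → ℝ≥0} (hG : Canonical f G) (hH : Canonical f H) :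
    Canonical f fun x => G x * H x := by
  obtain ⟨c, a, b, hc, ha, ha', hb, hb', hG⟩ := hG
  obtain ⟨c₁, a₁, b₁, hc₁, ha₁, ha₁', hb₁, hb₁', hH⟩ := hH
  refine ⟨c * c₁, fun p => a p * a₁ p, fun p q => b p q * b₁ p q, mul_ne_zero hc hc₁,
    fun p => mul_ne_zero (ha p) (ha₁ p), fun p hp => by simp [ha' p hp, ha₁' p hp],
    fun p q => one_le_mul (hb p q) (hb₁ p q), fun p q h => by simp [hb' p q h, hb₁' p q h], ?_⟩
  intro x hx
  have h1 : ∀ p, (if x p = true then a p * a₁ p else 1) =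
      (if x p = true then a p else 1) * (if x p = true then a₁ p else 1) := by
    intro p; split_ifs <;> simp
  have h2 : ∀ p q, (if x p = true ∧ x q = true then b p q * b₁ p q else 1) =
      (if x p = true ∧ x q = true then b p q else 1) *
        (if x p = true ∧ x q = true then b₁ p q else 1) := by
    intro p q; split_ifs <;> simp
  simp only [hG x hx, hH x hx, h1, h2, Finset.prod_mul_distrib]
  ring

theorem Canonical.const {c : ℝ≥0} (hc : c ≠ 0) : Canonical f fun _ => c :=
  ⟨c, fun _ => 1, fun _ _ => 1, hc, by simp, by simp, by simp, by simp, by simp⟩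

/-- On the support, `x i` either agrees with its representative or is constant, and in the latter
case so is the factor. -/
theorem Canonical.single {a : ℝ≥0} (ha : a ≠ 0) (i : Fin k) :
    Canonical f fun x => if x i = true then a else 1 := by
  by_cases h₁ : Takes f i true
  · by_cases h₀ : Takes f i false
    · obtain ⟨r, hr, hir, hri⟩ := exists_isRep h₁ h₀
      refine ⟨1, Function.update 1 r a, fun _ _ => 1, one_ne_zero, ?_, ?_, by simp, by simp, ?_⟩
      · intro p
        by_cases hp : p = r
        · subst hp; simpa using ha
        · simp [hp]
      · intro p hp
        have : p ≠ r := fun h => hp (h ▸ hr)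
        simp [this]
      · intro x hx
        have hxr : x i = true ↔ x r = true := ⟨hir x hx, hri x hx⟩
        rw [Finset.prod_eq_single r]
        · simp [hxr]
        · intro p _ hp; simp [hp]
        · simp
    · exact (Canonical.const ha).congr fun x hx => if_pos (by
        by_contra h
        exact h₀ ⟨x, hx, by simpa using h⟩)
  · exact (Canonical.const one_ne_zero).congr fun x hx => if_neg fun h => h₁ ⟨x, hx, h⟩

theorem Canonical.of_incomp {b : ℝ≥0} (hb : 1 ≤ b) {i j : Fin k} (h : Incomp f i j) :
    Canonical f fun x => if x i = true ∧ x j = true then b else 1 := by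
  classical
  refine ⟨1, fun _ => 1, fun p q => if p = i ∧ q = j then b else 1, one_ne_zero, by simp,
    by simp, ?_, ?_, ?_⟩
  · intro p q; dsimp only; split_ifs <;> simp [hb]
  · intro p q hpq
    refine if_neg ?_
    rintro ⟨rfl, rfl⟩
    exact hpq h
  · intro x hx
    simp only [ite_self, Finset.prod_const_one, one_mul]
    rw [Finset.prod_eq_single i (fun p _ hp => by simp [hp]) (by simp),
      Finset.prod_eq_single j (fun q _ hq => by simp [hq]) (by simp)]
    simp

/-- If one of the variables implies the other, their conjunction is the implying variable and the
pair collapses to a single weight. Otherwise neither is constant, so both have representatives;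
these are again incomparable and can be put in increasing order. -/
theorem Canonical.pair {b : ℝ≥0} (hb : 1 ≤ b) (i j : Fin k) :
    Canonical f fun x => if x i = true ∧ x j = true then b else 1 := by
  have hb0 : b ≠ 0 := (zero_lt_one.trans_le hb).ne'
  by_cases hij : Implies f i j
  · refine (Canonical.single hb0 i).congr fun x hx => ?_
    have := hij x hx
    by_cases h : x i = true <;> simp [h, this]
  by_cases hji : Implies f j i
  · refine (Canonical.single hb0 j).congr fun x hx => ?_
    have := hji x hx
    by_cases h : x j = true <;> simp [h, this]
  have h1 : ∀ {p q}, ¬ Implies f p q → Takes f p true := fun h => by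
    by_contra h'; exact h (implies_of_not_takes_true h' _)
  have h0 : ∀ {p q}, ¬ Implies f p q → Takes f q false := fun h => by
    by_contra h'; exact h (implies_of_not_takes h' _)
  obtain ⟨r, hr, hir, hri⟩ := exists_isRep (h1 hij) (h0 hji)
  obtain ⟨s, hs, hjs, hsj⟩ := exists_isRep (h1 hji) (h0 hij)
  have hrs : ¬ Implies f r s := fun h => hij ((hir.trans h).trans hsj)
  have hsr : ¬ Implies f s r := fun h => hji ((hjs.trans h).trans hri)
  have hx : ∀ x, f x ≠ 0 → ((x i = true ↔ x r = true) ∧ (x j = true ↔ x s = true)) :=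
    fun x hx => ⟨⟨hir x hx, hri x hx⟩, ⟨hjs x hx, hsj x hx⟩⟩
  rcases lt_trichotomy r s with h | rfl | h
  · refine (Canonical.of_incomp hb ⟨h, hr, hs, hrs, hsr⟩).congr fun x hfx => ?_
    simp only [(hx x hfx).1, (hx x hfx).2]
  · exact absurd (.refl r) hrs
  · refine (Canonical.of_incomp hb ⟨h, hs, hr, hsr, hrs⟩).congr fun x hfx => ?_
    simp only [(hx x hfx).1, (hx x hfx).2, and_comm]

/-- For `lam ≠ 0` the implication is `lam^(x_i) · (1/lam)^(x_i x_j)`, and `lam < 1` makes the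
interaction at least `1`. For `lam = 0` it equals `1` wherever it does not vanish. -/
theorem Canonical.factor (F : ImFactor k) (hF : ∀ x, f x ≠ 0 → F.eval x ≠ 0) :
    Canonical f fun x => F.eval x := by
  cases F with
  | unary i u =>
    -- A zero of `u` is never met on the support; replacing it by `1` makes the quotient `v true / v
    -- false` meaningful.
    let v : Bool → ℝ≥0 := fun b => if u b = 0 then 1 else u b
    have hv : ∀ b, v b ≠ 0 := by
      intro b
      dsimp only [v]
      split_ifs with h
      · exact one_ne_zero
      · exact h
    refine ((Canonical.const (hv false)).mul
      (Canonical.single (div_ne_zero (hv true) (hv false)) i)).congr fun x hx => ?_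
    have h := hF x hx
    simp only [ImFactor.eval] at h ⊢
    have : u (x i) = v (x i) := by simp [v, h]
    rw [this]
    cases x i with
    | true => simp [mul_div_cancel₀ _ (hv false)]
    | false => simp
  | imp i j lam hlam =>
    by_cases h0 : lam = 0
    · refine (Canonical.const one_ne_zero).congr fun x hx => ?_
      have h := hF x hx
      simp only [ImFactor.eval, h0] at h ⊢
      split_ifs at h ⊢ <;> simp_all
    · have h1 : 1 ≤ lam⁻¹ := (one_le_inv₀ (pos_iff_ne_zero.2 h0)).2 hlam.le
      refine ((Canonical.single h0 i).mul (Canonical.pair h1 i j)).congr fun x hx => ?_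
      simp only [ImFactor.eval]
      cases hi : x i <;> cases hj : x j <;> simp [h0]

theorem Canonical.of_factors (L : List (ImFactor k))
    (hL : ∀ F ∈ L, ∀ x, f x ≠ 0 → F.eval x ≠ 0) :
    Canonical f fun x => (L.map (ImFactor.eval x)).prod := by
  induction L with
  | nil => simpa using Canonical.const (f := f) one_ne_zero
  | cons F L ih =>
    simp only [List.map_cons, List.prod_cons]
    exact (Canonical.factor F (hL F (by simp))).mul
      (ih fun F' hF' => hL F' (List.mem_cons_of_mem _ hF'))

theorem Canonical.self {L : List (ImFactor k)}
    (hL : ∀ x, f x = (L.map (ImFactor.eval x)).prod) : Canonical f f := by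
  refine (Canonical.of_factors L ?_).congr fun x _ => hL x
  intro F hF x hx h
  refine hx ?_
  rw [hL]
  exact List.prod_eq_zero (List.mem_map.2 ⟨F, hF, h⟩)

/-! ### Recovering the parameters of the canonical form from values of the constraint. -/

/-- The set of consequences of `p` and the same set without the class of `p` differ, among
representatives, only in `p`. Everything in the first set is comparable with `p`, so no interaction
is lost with it, and the quotient is exactly `a p`. -/
theorem weight_eq {L : List (ImFactor k)} (hL : ∀ x, f x = (L.map (ImFactor.eval x)).prod)
    {c : ℝ≥0} {a : Fin k → ℝ≥0} {b : Fin k → Fin k → ℝ≥0}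
    (ha : ∀ p, ¬ IsRep f p → a p = 1) (hb : ∀ p q, ¬ Incomp f p q → b p q = 1)
    (hf : ∀ x, f x ≠ 0 → f x = c * (∏ p, if x p = true then a p else 1) *
      ∏ p, ∏ q, if x p = true ∧ x q = true then b p q else 1) {p : Fin k} (hp : IsRep f p) :
    weight f p = a p := by
  classical
  have hx := consequences_ne_zero hL hp hp false false
  have hy := consequences_ne_zero hL hp hp true true
  set x := consequences f p p false false with hxdef
  set y := consequences f p p true true with hydef
  have hx' : ∀ j, x j = true ↔ Implies f p j := by
    intro j; rw [hxdef, consequences_eq_true]; simp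
  have hy' : ∀ j, y j = true ↔ Implies f p j ∧ ¬ Implies f j p := by
    intro j; rw [hydef, consequences_eq_true]; simp
  have h1 : ∀ j, (if x j = true then a j else 1) =
      (if j = p then a p else 1) * (if y j = true then a j else 1) := by
    intro j
    simp only [hx', hy']
    by_cases hjp : j = p
    · subst hjp; simp [Implies.refl]
    · by_cases hj : IsRep f j
      · by_cases h : Implies f p j
        · have : ¬ Implies f j p := fun h' => hjp (hj.eq hp h' h)
          simp [h, this, hjp]
        · simp [h, hjp]
      · simp [hjp, ha j hj]
  have h2 : ∀ i j, (if x i = true ∧ x j = true then b i j else 1) =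
      (if y i = true ∧ y j = true then b i j else 1) := by
    intro i j
    by_cases hij : Incomp f i j
    · obtain ⟨-, hi, hj, hn, hn'⟩ := hij
      have key : x i = true ∧ x j = true ↔ y i = true ∧ y j = true := by
        simp only [hx', hy']
        constructor
        · rintro ⟨h, h'⟩
          exact ⟨⟨h, fun h'' => hn (h''.trans h')⟩, ⟨h', fun h'' => hn' (h''.trans h)⟩⟩
        · rintro ⟨h, h'⟩
          exact ⟨h.1, h'.1⟩
      simp only [key]
    · simp [hb i j hij]
  have h3 : f x = a p * f y := by
    rw [hf x hx, hf y hy]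
    simp only [h1, h2, Finset.prod_mul_distrib, Finset.prod_ite_eq', Finset.mem_univ, if_true]
    ring
  rw [weight, ← hxdef, ← hydef, h3, mul_div_assoc, div_self hy, mul_one]

/-- A second difference of the logarithm of `f`. Representatives other than `p` and `q` lie in all
four sets or in none, so the constant, the single weights and all other interactions cancel; only
the set with both `p` and `q` sees `b p q`. -/
theorem interaction_eq {L : List (ImFactor k)} (hL : ∀ x, f x = (L.map (ImFactor.eval x)).prod)
    {c : ℝ≥0} {a : Fin k → ℝ≥0} {b : Fin k → Fin k → ℝ≥0}
    (ha : ∀ p, ¬ IsRep f p → a p = 1) (hb : ∀ p q, ¬ Incomp f p q → b p q = 1)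
    (hf : ∀ x, f x ≠ 0 → f x = c * (∏ p, if x p = true then a p else 1) *
      ∏ p, ∏ q, if x p = true ∧ x q = true then b p q else 1) {p q : Fin k}
    (hpq : Incomp f p q) : interaction f p q = b p q := by
  classical
  obtain ⟨hlt, hp, hq, hn, hn'⟩ := hpq
  have hx := consequences_ne_zero hL hp hq
  have aux : ∀ {t a₁ a₂ a₃ a₄ b₁ b₂ b₃ b₄ : ℝ≥0}, a₁ * a₂ = a₃ * a₄ →
      b₁ * b₂ = t * (b₃ * b₄) →
      c * a₁ * b₁ * (c * a₂ * b₂) = t * (c * a₃ * b₃ * (c * a₄ * b₄)) := by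
    intro t a₁ a₂ a₃ a₄ b₁ b₂ b₃ b₄ h h'
    calc _ = c * c * (a₁ * a₂) * (b₁ * b₂) := by ring
      _ = _ := by rw [h, h']; ring
  -- A representative other than `p` and `q` that lies above one of them lies below neither:
  -- otherwise it would coincide with one of them, or make `p` and `q` comparable. So `s` and `t`
  -- affect only `p` and `q`.
  have hmem : ∀ (s t : Bool) (j : Fin k), IsRep f j →
      (consequences f p q s t j = true ↔
        if j = p then s = false else if j = q then t = false else
          consequences f p q false false j = true) := by
    intro s t j hj
    simp only [consequences_eq_true]
    split_ifs with h h'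
    · subst h
      simp [Implies.refl, hn]
    · subst h'
      simp [Implies.refl, hn']
    · simp only [false_and, not_false_eq_true, and_true, and_iff_left_iff_imp]
      rintro (h₁ | h₁)
      · exact ⟨fun h₂ => h (hj.eq hp h₂.2 h₁), fun h₂ => hn (h₁.trans h₂.2)⟩
      · exact ⟨fun h₂ => hn' (h₁.trans h₂.2), fun h₂ => h' (hj.eq hq h₂.2 h₁)⟩
  have h1 : ∀ j, (if consequences f p q false false j = true then a j else 1) *
      (if consequences f p q true true j = true then a j else 1) =
      (if consequences f p q true false j = true then a j else 1) *
      (if consequences f p q false true j = true then a j else 1) := by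
    intro j
    by_cases hj : IsRep f j
    · simp only [hmem true true j hj, hmem true false j hj, hmem false true j hj]
      by_cases hjp : j = p
      · subst hjp
        simp [(hmem false false j hj)]
      · by_cases hjq : j = q
        · subst hjq
          simp [(hmem false false j hj), hjp]
        · simp [hjp, hjq]
    · simp [ha j hj]
  have h2 : ∀ i j, (if consequences f p q false false i = true ∧
        consequences f p q false false j = true then b i j else 1) *
      (if consequences f p q true true i = true ∧
        consequences f p q true true j = true then b i j else 1) =
      (if i = p then if j = q then b p q else 1 else 1) *
      ((if consequences f p q true false i = true ∧
        consequences f p q true false j = true then b i j else 1) *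
      (if consequences f p q false true i = true ∧
        consequences f p q false true j = true then b i j else 1)) := by
    intro i j
    by_cases hij : Incomp f i j
    · have hi := hij.2.1
      have hj := hij.2.2.1
      have hne : i ≠ j := hij.1.ne
      -- `Incomp` lists a pair in increasing order only, so the reversed pair carries no second
      -- interaction.
      have hqp : ¬ (i = q ∧ j = p) := by
        rintro ⟨rfl, rfl⟩
        exact absurd hij.1 (not_lt.2 hlt.le)
      have hpq' : p ≠ q := hlt.ne
      simp only [hmem true true i hi, hmem true false i hi, hmem false true i hi,
        hmem true true j hj, hmem true false j hj, hmem false true j hj]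
      have hCp : consequences f p q false false p = true := (hmem false false p hp).2 (by simp)
      have hCq : consequences f p q false false q = true :=
        (hmem false false q hq).2 (by simp [hpq'.symm])
      by_cases hip : i = p
      · have hjp : j ≠ p := fun h => hne (hip.trans h.symm)
        by_cases hjq : j = q
        · simp [hip, hjq, hCp, hCq, hpq'.symm]
        · simp [hip, hjp, hjq, hCp]
      · by_cases hiq : i = q
        · have hjq : j ≠ q := fun h => hne (hiq.trans h.symm)
          have hjp : j ≠ p := fun h => hqp ⟨hiq, h⟩
          simp [hiq, hjp, hjq, hCq, hpq'.symm]
        · by_cases hjp : j = p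
          · simp [hip, hiq, hjp, hCp]
          · by_cases hjq : j = q
            · simp [hip, hiq, hjq, hCq, hpq'.symm]
            · simp [hip, hiq, hjp, hjq]
    · have hne : ¬ (i = p ∧ j = q) := by
        rintro ⟨rfl, rfl⟩
        exact hij ⟨hlt, hp, hq, hn, hn'⟩
      by_cases hip : i = p
      · have : j ≠ q := fun h => hne ⟨hip, h⟩
        simp [hb i j hij, this]
      · simp [hb i j hij, hip]
  have h3 : f (consequences f p q false false) * f (consequences f p q true true) =
      b p q * (f (consequences f p q true false) * f (consequences f p q false true)) := by
    rw [hf _ (hx false false), hf _ (hx true true), hf _ (hx true false), hf _ (hx false true)]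
    have e₁ := Finset.prod_congr (rfl : (Finset.univ : Finset (Fin k)) = _) fun j _ => h1 j
    have e₂ := Finset.prod_congr (rfl : (Finset.univ : Finset (Fin k)) = _) fun i _ =>
      Finset.prod_congr (rfl : (Finset.univ : Finset (Fin k)) = _) fun j _ => h2 i j
    have e₃ : (∏ i : Fin k, ∏ j : Fin k, if i = p then if j = q then b p q else 1 else 1) =
        b p q := by
      rw [Finset.prod_eq_single p (fun i _ hi => by simp [hi]) (by simp),
        Finset.prod_eq_single q (fun j _ hj => by simp [hj]) (by simp)]
      simp
    simp only [Finset.prod_mul_distrib] at e₁ e₂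
    rw [e₃] at e₂
    exact aux e₁ e₂
  rw [interaction, h3, mul_div_assoc,
    div_self (mul_ne_zero (hx true false) (hx false true)), mul_one]

/-! ### The flow gadget of a single constraint. -/

open Classical in
/-- The flow rate contributed by the pair `p`, `q`. -/
noncomputable def edgeFactor (f : (Fin k → Bool) → ℝ≥0) (p q : Fin k) : ℝ≥0 :=
  if Incomp f p q then interaction f p q else 1

open Classical in
/-- The influx rate contributed by the variable `q`. -/
noncomputable def vertexFactor (f : (Fin k → Bool) → ℝ≥0) (q : Fin k) : ℝ≥0 :=
  (if Takes f q true then if IsRep f q then weight f q else 1 else 0) * ∏ p, edgeFactor f p q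

/-- The edge `(p,q)` pays its rate `b` unless `x p` is false and `x q` is true. Multiplied by
`b^(x_q)` this is `b · b^(x_p x_q)`: the interaction up to a constant. Collecting these constants,
and dividing by that of the canonical form, gives `c`. -/
theorem exists_flow_form {L : List (ImFactor k)}
    (hL : ∀ x, f x = (L.map (ImFactor.eval x)).prod) :
    (∀ p q, 1 ≤ edgeFactor f p q) ∧ ∃ c : ℝ≥0, c ≠ 0 ∧ ∀ x, f x ≠ 0 →
      (∏ q, if x q = true then vertexFactor f q else 1) *
        (∏ p, ∏ q, if x q ≤ x p then edgeFactor f p q else 1) = c * f x := by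
  classical
  obtain ⟨c, a, b, hc, ha0, ha, hb1, hb, hf⟩ := Canonical.self hL
  have hedge : ∀ p q, edgeFactor f p q = b p q := by
    intro p q
    rw [edgeFactor]
    split_ifs with h
    · exact interaction_eq hL ha hb hf h
    · exact (hb p q h).symm
  refine ⟨fun p q => hedge p q ▸ hb1 p q, (∏ p, ∏ q, b p q) / c,
    div_ne_zero (Finset.prod_ne_zero_iff.2 fun p _ => Finset.prod_ne_zero_iff.2 fun q _ =>
      (zero_lt_one.trans_le (hb1 p q)).ne') hc, ?_⟩
  intro x hx
  have h1 : ∀ q, (if x q = true then vertexFactor f q else 1) =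
      (if x q = true then a q else 1) * ∏ p, if x q = true then b p q else 1 := by
    intro q
    split_ifs with h
    · rw [vertexFactor, if_pos ⟨x, hx, h⟩]
      simp only [hedge]
      congr 1
      split_ifs with hq
      · exact weight_eq hL ha hb hf hq
      · exact (ha q hq).symm
    · simp
  have h2 : ∀ p q, (if x q = true then b p q else 1) * (if x q ≤ x p then b p q else 1) =
      b p q * (if x p = true ∧ x q = true then b p q else 1) := by
    intro p q
    cases x p <;> cases x q <;> simp
  have e₂ := Finset.prod_congr (rfl : (Finset.univ : Finset (Fin k)) = _) fun i _ =>
      Finset.prod_congr (rfl : (Finset.univ : Finset (Fin k)) = _) fun j _ => h2 i j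
  simp only [Finset.prod_mul_distrib] at e₂
  simp only [hedge, h1, Finset.prod_mul_distrib]
  rw [Finset.prod_comm, mul_assoc, e₂, hf x hx]
  field_simp

end Structure

/-! ### Hard conditions enforced by a penalty -/

open Classical in
/-- Among the factors `ρ i` with `act σ i` the hard ones are multiplied by a large number. Then
feasible points keep their measure up to a constant, and the other points become worse than any
feasible one by a factor of at least `2`. -/
theorem penalty_spec {S ι : Type*} [Fintype ι] (act : S → ι → Prop) (ρ : ι → ℝ≥0)
    (H : ι → Prop) (m : S → ℝ≥0) {c : ℝ≥0} (hc : c ≠ 0)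
    (h₁ : ∀ σ, m σ ≠ 0 → (∏ i, if act σ i then ρ i else 1) = c * m σ ∧ ∀ i, H i → act σ i)
    (h₂ : ∀ σ, m σ = 0 → (∏ i, if act σ i then ρ i else 1) = 0 ∨ ∃ i, H i ∧ ¬ act σ i)
    (K : ℝ≥0) (hK : K = 2 * ∏ i, (1 + ρ i) * (1 + 1 / ρ i)) (fl : S → ℝ≥0)
    (hfl : ∀ σ, fl σ = ∏ i, if act σ i then ρ i * (if H i then K else 1) else 1) :
    ∃ C : ℝ≥0, C ≠ 0 ∧ (∀ σ, m σ ≠ 0 → fl σ = C * m σ) ∧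
      ∀ σ τ, m σ = 0 → m τ ≠ 0 → 2 * fl σ ≤ fl τ := by
  have hK1 : 1 ≤ K := by
    rw [hK]
    refine one_le_mul one_le_two (Finset.one_le_prod' fun i _ => one_le_mul ?_ ?_) <;> simp
  have hK0 : K ≠ 0 := (zero_lt_one.trans_le hK1).ne'
  set N : ℝ≥0 := ∏ i, if H i then K else 1 with hN
  have hN0 : N ≠ 0 := Finset.prod_ne_zero_iff.2 fun i _ => by split_ifs <;> simp [hK0]
  have hsplit : ∀ σ, fl σ = (∏ i, if act σ i then ρ i else 1) *
      ∏ i, if act σ i ∧ H i then K else 1 := by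
    intro σ
    rw [hfl, ← Finset.prod_mul_distrib]
    refine Finset.prod_congr rfl fun i _ => ?_
    by_cases h : act σ i <;> simp [h]
  have hfeas : ∀ σ, m σ ≠ 0 → fl σ = (∏ i, if act σ i then ρ i else 1) * N := by
    intro σ hσ
    rw [hsplit, hN]
    congr 1
    refine Finset.prod_congr rfl fun i _ => ?_
    have := (h₁ σ hσ).2 i
    by_cases h : H i <;> simp [h, this]
  refine ⟨c * N, mul_ne_zero hc hN0, fun σ hσ => ?_, fun σ τ hσ hτ => ?_⟩
  · rw [hfeas σ hσ, (h₁ σ hσ).1]; ring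
  · rcases h₂ σ hσ with h | ⟨j, hj, hnj⟩
    · rw [hsplit, h]; simp
    · have hhard : K * (∏ i, if act σ i ∧ H i then K else 1) ≤ N := by
        have : (∏ i, if i = j then K else 1) = K := by simp
        rw [hN, ← this, ← Finset.prod_mul_distrib, this]
        refine Finset.prod_le_prod' fun i _ => ?_
        by_cases hij : i = j
        · subst hij; simp [hnj, hj]
        · by_cases h : act σ i <;> by_cases h' : H i <;> simp [hij, h, h', hK1]
      have hup : (∏ i, if act σ i then ρ i else 1) ≤ ∏ i, (1 + ρ i) := by
        refine Finset.prod_le_prod' fun i _ => ?_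
        split_ifs <;> simp
      have hτ0 : ∀ i, act τ i → ρ i ≠ 0 := by
        intro i hi h0
        have : (∏ i, if act τ i then ρ i else 1) = 0 :=
          Finset.prod_eq_zero (Finset.mem_univ i) (by simp [hi, h0])
        rw [(h₁ τ hτ).1] at this
        exact mul_ne_zero hc hτ this
      -- An active factor at the feasible point `τ` is nonzero, and `ρ (1 + 1/ρ) = ρ + 1`. An
      -- inactive one leaves `1 + 1/ρ`, which is at least `1` even for `ρ = 0`, where `1 / ρ = 0`.
      have hlow : 1 ≤ (∏ i, if act τ i then ρ i else 1) * ∏ i, (1 + 1 / ρ i) := by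
        rw [← Finset.prod_mul_distrib]
        refine Finset.one_le_prod' fun i _ => ?_
        split_ifs with h
        · have := hτ0 i h
          rw [mul_add, mul_one, mul_one_div, div_self this]
          simp
        · simp
      rw [hfeas τ hτ, hsplit σ]
      have hKpos : 0 < K := pos_iff_ne_zero.2 hK0
      refine le_of_mul_le_mul_left ?_ hKpos
      calc K * (2 * ((∏ i, if act σ i then ρ i else 1) * ∏ i, if act σ i ∧ H i then K else 1))
          = 2 * (∏ i, if act σ i then ρ i else 1) *
              (K * ∏ i, if act σ i ∧ H i then K else 1) := by ring
        _ ≤ 2 * (∏ i, (1 + ρ i)) * N := by gcongr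
        _ = 2 * (∏ i, (1 + ρ i)) * N * 1 := by ring
        _ ≤ 2 * (∏ i, (1 + ρ i)) * N *
              ((∏ i, if act τ i then ρ i else 1) * ∏ i, (1 + 1 / ρ i)) := by gcongr
        _ = K * ((∏ i, if act τ i then ρ i else 1) * N) := by
          rw [hK, Finset.prod_mul_distrib]; ring

/-- Approximate solutions with respect to `fl` are approximate solutions with respect to `m`. -/
theorem isApprox_of_penalty {S : Type*} {m fl : S → ℝ≥0} {C : ℝ≥0} (hC : C ≠ 0)
    (h₁ : ∀ σ, m σ ≠ 0 → fl σ = C * m σ)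
    (h₂ : ∀ σ τ, m σ = 0 → m τ ≠ 0 → 2 * fl σ ≤ fl τ) {α : ℝ} (hα0 : 0 < α) (hα : α < 2) {y : S}
    (h : ∃ v, IsGreatest (Set.range fun σ => (fl σ : ℝ)) v ∧ (v = 0 → (fl y : ℝ) = 0) ∧
      (v ≠ 0 → 1 / α ≤ |(fl y : ℝ) / v| ∧ |(fl y : ℝ) / v| ≤ α)) :
    ∃ v, IsGreatest (Set.range fun σ => (m σ : ℝ)) v ∧ (v = 0 → (m y : ℝ) = 0) ∧
      (v ≠ 0 → 1 / α ≤ |(m y : ℝ) / v| ∧ |(m y : ℝ) / v| ≤ α) := by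
  -- With no feasible point the measure is identically zero and every answer is optimal.
  by_cases hall : ∀ σ, m σ = 0
  · refine ⟨0, ⟨⟨y, by simp [hall y]⟩, ?_⟩, fun _ => by simp [hall y], fun h => absurd rfl h⟩
    rintro _ ⟨σ, rfl⟩
    simp [hall σ]
  push Not at hall
  obtain ⟨τ, hτ⟩ := hall
  obtain ⟨v, ⟨⟨y₀, rfl⟩, hmax⟩, -, happ⟩ := h
  have hCpos : (0 : ℝ) < C := NNReal.coe_pos.2 (pos_iff_ne_zero.2 hC)
  have hτpos : (0 : ℝ) < fl τ := by
    rw [h₁ τ hτ]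
    exact NNReal.coe_pos.2 (pos_iff_ne_zero.2 (mul_ne_zero hC hτ))
  have hτle : (fl τ : ℝ) ≤ fl y₀ := hmax ⟨τ, rfl⟩
  have hvpos : (0 : ℝ) < fl y₀ := hτpos.trans_le hτle
  have h₂' : ∀ σ, m σ = 0 → 2 * (fl σ : ℝ) ≤ fl τ := fun σ hσ => by
    exact_mod_cast h₂ σ τ hσ hτ
  have hy₀ : m y₀ ≠ 0 := fun h0 => by
    have := h₂' y₀ h0
    linarith
  dsimp only at happ
  obtain ⟨ha, hb⟩ := happ hvpos.ne'
  -- An infeasible `y` reaches at most half of the optimum, whereas the approximation ratio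
  -- guarantees more than half because `α < 2`.
  have hy : m y ≠ 0 := fun h0 => by
    have h3 := h₂' y h0
    rw [abs_of_nonneg (by positivity), div_le_div_iff₀ hα0 hvpos] at ha
    have : (fl y : ℝ) * α ≤ fl y * 2 := by gcongr
    have h4 : (fl y : ℝ) * α = 1 * fl y₀ := by linarith
    have h5 : 0 < (fl y : ℝ) := by
      by_contra h6
      have : (fl y : ℝ) = 0 := le_antisymm (not_lt.1 h6) (NNReal.coe_nonneg _)
      rw [this] at h4
      linarith
    have : (fl y : ℝ) * α < fl y * 2 := by gcongr
    linarith
  have hratio : (fl y : ℝ) / fl y₀ = m y / m y₀ := by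
    rw [h₁ y hy, h₁ y₀ hy₀]
    push_cast
    exact mul_div_mul_left _ _ hCpos.ne'
  refine ⟨m y₀, ⟨⟨y₀, rfl⟩, ?_⟩, fun h => absurd h (NNReal.coe_ne_zero.2 hy₀), fun _ => ?_⟩
  · rintro _ ⟨σ, rfl⟩
    by_cases hσ : m σ = 0
    · simp [hσ]
    · have h3 : (fl σ : ℝ) ≤ fl y₀ := hmax ⟨σ, rfl⟩
      rw [h₁ σ hσ, h₁ y₀ hy₀] at h3
      push_cast at h3
      exact le_of_mul_le_mul_left h3 hCpos
  · rw [← hratio]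
    exact ⟨ha, hb⟩

/-! ### The flow instance of an instance of the constraint problem -/

section Instance

variable {F : Set Constraint} (x : CSPInst F)

/-- The constraint of an application of the instance. -/
def CSPInst.fn (i : Fin x.apps.length) : (Fin (x.apps[i]).h.arity → Bool) → ℝ≥0 :=
  (x.apps[i]).h.val

def CSPInst.arg (i : Fin x.apps.length) : Fin (x.apps[i]).h.arity → Fin x.n := (x.apps[i]).args

/-- The influx rate of a vertex, without penalty. -/
noncomputable def CSPInst.softInflux (z : Fin x.n) : ℝ≥0 :=
  ∏ i, ∏ q, if x.arg i q = z then vertexFactor (x.fn i) q else 1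

/-- The flow rate of an edge, without penalty. -/
noncomputable def CSPInst.softRate (y z : Fin x.n) : ℝ≥0 :=
  ∏ i, ∏ p, ∏ q, if x.arg i p = y ∧ x.arg i q = z then edgeFactor (x.fn i) p q else 1

/-- Only forced truth needs a penalty: a variable that is forced to be false has influx `0` through
`vertexFactor`. -/
def CSPInst.HardVertex (z : Fin x.n) : Prop :=
  ∃ i q, x.arg i q = z ∧ ¬ Takes (x.fn i) q false

/-- The edge `(y,z)` pays exactly when truth of `z` entails truth of `y`, so the implication runs
from `q` to `p`. By reflexivity loops can be hard too, harmlessly, since a loop always pays. -/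
def CSPInst.HardEdge (y z : Fin x.n) : Prop :=
  ∃ i p q, x.arg i p = y ∧ x.arg i q = z ∧ Implies (x.fn i) q p

/-- The factor by which the rates of hard vertices and edges are multiplied. -/
noncomputable def CSPInst.penalty : ℝ≥0 :=
  2 * ((∏ z, (1 + x.softInflux z) * (1 + 1 / x.softInflux z)) *
    ∏ y, ∏ z, (1 + x.softRate y z) * (1 + 1 / x.softRate y z))

open Classical in
noncomputable def CSPInst.influx (z : Fin x.n) : ℝ≥0 :=
  x.softInflux z * if x.HardVertex z then x.penalty else 1

open Classical in
noncomputable def CSPInst.rate (y z : Fin x.n) : ℝ≥0 :=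
  x.softRate y z * if x.HardEdge y z then x.penalty else 1

theorem CSPInst.one_le_penalty : 1 ≤ x.penalty := by
  have h : ∀ r : ℝ≥0, 1 ≤ (1 + r) * (1 + 1 / r) := fun r => one_le_mul (by simp) (by simp)
  exact one_le_mul one_le_two (one_le_mul (Finset.one_le_prod' fun _ _ => h _)
    (Finset.one_le_prod' fun _ _ => Finset.one_le_prod' fun _ _ => h _))

theorem CSPInst.exists_factors (hF : F ⊆ IMopt) (i : Fin x.apps.length) :
    ∃ L : List (ImFactor (x.apps[i]).h.arity), ∀ σ, x.fn i σ = (L.map (ImFactor.eval σ)).prod :=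
  hF (x.mem _ (List.getElem_mem i.2))

theorem CSPInst.one_le_rate (hF : F ⊆ IMopt) (y z : Fin x.n) : 1 ≤ x.rate y z := by
  refine one_le_mul ?_ (by split_ifs <;> simp [x.one_le_penalty])
  refine Finset.one_le_prod' fun i _ => Finset.one_le_prod' fun p _ =>
    Finset.one_le_prod' fun q _ => ?_
  obtain ⟨L, hL⟩ := x.exists_factors hF i
  have := (exists_flow_form hL).1 p q
  split_ifs <;> simp [this]

/-- The flow instance on the complete directed graph. -/
noncomputable def CSPInst.toFlow (hF : F ⊆ IMopt) : FlowInst where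
  n := x.n
  edges := (List.finRange x.n).flatMap fun y => (List.finRange x.n).map fun z =>
    ((y, z), (x.rate y z : ℝ))
  nodup := by
    have h : ((List.finRange x.n).flatMap fun y => (List.finRange x.n).map fun z =>
        ((y, z), (x.rate y z : ℝ))).map Prod.fst = List.finRange x.n ×ˢ List.finRange x.n := by
      simp only [List.map_flatMap, List.map_map]
      rfl
    rw [h]
    exact (List.nodup_finRange _).product (List.nodup_finRange _)
  one_le := by
    intro e he
    simp only [List.mem_flatMap, List.mem_map] at he
    obtain ⟨y, -, z, -, rfl⟩ := he
    exact_mod_cast x.one_le_rate hF y z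
  influx := x.influx

theorem CSPInst.toFlow_measure (hF : F ⊆ IMopt) (σ : Fin x.n → Bool) :
    maxProdFlow.measure (x.toFlow hF) σ =
      (((∏ z, if σ z = true then x.influx z else 1) *
        ∏ y, ∏ z, if σ z ≤ σ y then x.rate y z else 1 : ℝ≥0) : ℝ) := by
  have h : ∀ l : List ((Fin x.n × Fin x.n) × ℝ),
      ((l.filter fun e => decide (σ e.1.1 ≥ σ e.1.2)).map Prod.snd).prod =
        (l.map fun e => if σ e.1.2 ≤ σ e.1.1 then e.2 else 1).prod := by
    intro l
    induction l with
    | nil => simp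
    | cons e l ih =>
      by_cases he : σ e.1.2 ≤ σ e.1.1
      · rw [List.filter_cons_of_pos (by simpa using he)]; simp [ih, he]
      · rw [List.filter_cons_of_neg (by simpa using he)]; simp [ih, he]
  have h' : ((x.toFlow hF).edges.map fun e => if σ e.1.2 ≤ σ e.1.1 then e.2 else 1).prod =
      ∏ y, ∏ z, if σ z ≤ σ y then (x.rate y z : ℝ) else 1 := by
    simp only [toFlow, List.map_flatMap, List.map_map, Function.comp_def]
    rw [List.flatMap, List.prod_flatten, List.map_map, ← List.ofFn_eq_map, List.prod_ofFn]
    refine Finset.prod_congr rfl fun y _ => ?_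
    simp only [Function.comp_def]
    rw [← List.ofFn_eq_map, List.prod_ofFn]
  refine (congrArg₂ (· * ·) ((h _).trans h')
    (Finset.prod_filter (fun z => σ z = true) fun z => (x.influx z : ℝ))).trans ?_
  rw [mul_comm]
  push_cast
  congr 1
  · exact Finset.prod_congr rfl fun z _ => by split_ifs <;> simp
  · exact Finset.prod_congr rfl fun z _ => Finset.prod_congr rfl fun z _ => by
      split_ifs <;> simp

theorem prod_prod_comm {α β γ : Type*} [Fintype α] [Fintype β] [Fintype γ]
    (g : α → β → γ → ℝ≥0) : (∏ y, ∏ z, ∏ i, g y z i) = ∏ i, ∏ y, ∏ z, g y z i :=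
  (Finset.prod_congr rfl fun _ _ => Finset.prod_comm).trans Finset.prod_comm

/-- Each argument of an application contributes to one vertex, and each ordered pair of arguments to
one edge, so the products over vertices and edges can be regrouped by applications. This covers
repeated arguments, whose contributions fall on loops. -/
theorem CSPInst.soft_measure (σ : Fin x.n → Bool) :
    (∏ z, if σ z = true then x.softInflux z else 1) *
        (∏ y, ∏ z, if σ z ≤ σ y then x.softRate y z else 1) =
      ∏ i, (∏ q, if σ (x.arg i q) = true then vertexFactor (x.fn i) q else 1) *
        (∏ p, ∏ q, if σ (x.arg i q) ≤ σ (x.arg i p) then edgeFactor (x.fn i) p q else 1) := by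
  rw [Finset.prod_mul_distrib]
  congr 1
  · have h : ∀ z, (if σ z = true then x.softInflux z else 1) = ∏ i, ∏ q, if x.arg i q = z then
        (if σ z = true then vertexFactor (x.fn i) q else 1) else 1 := by
      intro z
      split_ifs <;> simp [softInflux]
    simp only [h]
    rw [Finset.prod_comm]
    refine Finset.prod_congr rfl fun i _ => ?_
    rw [Finset.prod_comm]
    simp
  · have h : ∀ y z, (if σ z ≤ σ y then x.softRate y z else 1) = ∏ i, ∏ p, ∏ q,
        if x.arg i p = y then if x.arg i q = z then
          (if σ z ≤ σ y then edgeFactor (x.fn i) p q else 1) else 1 else 1 := by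
      intro y z
      split_ifs <;> simp [softRate, ite_and]
    simp only [h]
    rw [prod_prod_comm]
    refine Finset.prod_congr rfl fun i _ => ?_
    rw [prod_prod_comm]
    refine Finset.prod_congr rfl fun p _ => ?_
    rw [prod_prod_comm]
    refine Finset.prod_congr rfl fun q _ => ?_
    rw [Finset.prod_eq_single (x.arg i p) (fun y _ hy => by simp [Ne.symm hy]) (by simp)]
    simp

theorem CSPInst.measure_eq (σ : Fin x.n → Bool) :
    (maxProdCSP F).measure x σ = ((∏ i, x.fn i fun p => σ (x.arg i p) : ℝ≥0) : ℝ) := by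
  show ((_ : ℝ≥0) : ℝ) = _
  congr 1
  rw [← List.prod_ofFn]
  congr 1
  refine List.ext_getElem (by simp) fun i h h' => ?_
  simp [fn, arg]

/-- The flow instance has the same approximate solutions. -/
theorem CSPInst.isApprox_of_toFlow (hF : F ⊆ IMopt) {ε : ℝ} (hε : ε < 1) (σ : Fin x.n → Bool)
    (h : maxProdFlow.IsApprox ((2 : ℝ) ^ ε) (x.toFlow hF) σ) :
    (maxProdCSP F).IsApprox ((2 : ℝ) ^ ε) x σ := by
  classical
  have hform := fun i => (exists_flow_form (x.exists_factors hF i).choose_spec).2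
  choose c hc hflow using hform
  -- Vertices and edges form one index set, so that a single penalty argument covers both.
  let act : (Fin x.n → Bool) → (Fin x.n ⊕ Fin x.n × Fin x.n) → Prop := fun τ =>
    Sum.elim (fun z => τ z = true) fun e => τ e.2 ≤ τ e.1
  let ρ : (Fin x.n ⊕ Fin x.n × Fin x.n) → ℝ≥0 :=
    Sum.elim x.softInflux fun e => x.softRate e.1 e.2
  let H : (Fin x.n ⊕ Fin x.n × Fin x.n) → Prop :=
    Sum.elim x.HardVertex fun e => x.HardEdge e.1 e.2
  let m : (Fin x.n → Bool) → ℝ≥0 := fun τ => ∏ i, x.fn i fun p => τ (x.arg i p)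
  let fl : (Fin x.n → Bool) → ℝ≥0 := fun τ =>
    (∏ z, if τ z = true then x.influx z else 1) *
      ∏ y, ∏ z, if τ z ≤ τ y then x.rate y z else 1
  have hsoft : ∀ τ, (∏ i, if act τ i then ρ i else 1) =
      ∏ i, (∏ q, if τ (x.arg i q) = true then vertexFactor (x.fn i) q else 1) *
        (∏ p, ∏ q, if τ (x.arg i q) ≤ τ (x.arg i p) then edgeFactor (x.fn i) p q else 1) := by
    intro τ
    rw [← x.soft_measure τ, Fintype.prod_sum_type, Fintype.prod_prod_type]
    exact (congrArg₂ (· * ·) (Finset.prod_congr rfl fun z _ => if_congr Iff.rfl rfl rfl)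
      (Finset.prod_congr rfl fun y _ => Finset.prod_congr rfl fun z _ =>
        if_congr Iff.rfl rfl rfl))
  obtain ⟨C, hC, h₁, h₂⟩ := penalty_spec act ρ H m (c := ∏ i, c i)
    (Finset.prod_ne_zero_iff.2 fun i _ => hc i)
    (by
      intro τ hτ
      have hi : ∀ i, x.fn i (fun p => τ (x.arg i p)) ≠ 0 := fun i =>
        Finset.prod_ne_zero_iff.1 hτ i (Finset.mem_univ i)
      refine ⟨?_, ?_⟩
      · rw [hsoft, ← Finset.prod_mul_distrib]
        exact Finset.prod_congr rfl fun i _ => hflow i _ (hi i)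
      · rintro (z | ⟨y, z⟩) hz
        · obtain ⟨i, q, rfl, hq⟩ := hz
          show τ _ = true
          by_contra hn
          exact hq ⟨_, hi i, by simpa using hn⟩
        · obtain ⟨i, p, q, rfl, rfl, hq⟩ := hz
          show τ (x.arg i q) ≤ τ (x.arg i p)
          rw [Bool.le_iff_imp]
          exact hq _ (hi i))
    (by
      intro τ hτ
      obtain ⟨i, -, hi⟩ := Finset.prod_eq_zero_iff.1 hτ
      by_contra hcon
      push Not at hcon
      obtain ⟨hs, hact⟩ := hcon
      -- If the soft product is nonzero and all hard conditions hold, the vanishing constraint must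
      -- be nonzero after all: hard edges give closure under implication, hard vertices rule out a
      -- false value where truth is forced, and the zero influx rules out a true value where falsity
      -- is forced.
      refine ne_zero_of_closed (x.exists_factors hF i).choose_spec ?_ ?_ hi
      · intro p q hpq hp
        have : τ (x.arg i p) ≤ τ (x.arg i q) := hact (.inr (x.arg i q, x.arg i p))
          ⟨i, q, p, rfl, rfl, hpq⟩
        exact Bool.le_iff_imp.1 this hp
      · intro p
        by_contra hp
        cases hx : τ (x.arg i p) with
        | false =>
          rw [hx] at hp
          have : τ (x.arg i p) = true := hact (.inl (x.arg i p)) ⟨i, p, rfl, hp⟩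
          simp [this] at hx
        | true =>
          rw [hx] at hp
          refine hs ?_
          rw [hsoft]
          refine Finset.prod_eq_zero (Finset.mem_univ i) ?_
          rw [Finset.prod_eq_zero (Finset.mem_univ p), zero_mul]
          rw [if_pos hx, vertexFactor, if_neg hp, zero_mul])
    x.penalty
    (by rw [Fintype.prod_sum_type, Fintype.prod_prod_type]; rfl)
    fl
    (by
      intro τ
      rw [Fintype.prod_sum_type, Fintype.prod_prod_type]
      exact (congrArg₂ (· * ·) (Finset.prod_congr rfl fun z _ => if_congr Iff.rfl rfl rfl)
        (Finset.prod_congr rfl fun y _ => Finset.prod_congr rfl fun z _ =>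
          if_congr Iff.rfl rfl rfl)))
  have hP : ∀ τ, (maxProdCSP F).measure x τ = (m τ : ℝ) := x.measure_eq
  have hQ : ∀ τ, maxProdFlow.measure (x.toFlow hF) τ = (fl τ : ℝ) := x.toFlow_measure hF
  have hP' : (maxProdCSP F).measure x = fun τ => (m τ : ℝ) := funext hP
  have hQ' : maxProdFlow.measure (x.toFlow hF) = fun τ => (fl τ : ℝ) := funext hQ
  -- The inequality must be strict, because the penalty guarantees only a factor of `2` between
  -- feasible and infeasible points.
  have hα : (2 : ℝ) ^ ε < 2 := by
    calc (2 : ℝ) ^ ε < 2 ^ (1 : ℝ) := Real.rpow_lt_rpow_of_exponent_lt one_lt_two hε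
      _ = 2 := Real.rpow_one 2
  have key := isApprox_of_penalty hC h₁ h₂ (Real.rpow_pos_of_pos two_pos ε) hα (y := σ)
  simp only [MaxProblem.IsApprox, MaxProblem.IsOptimum] at h ⊢
  rw [hP']
  rw [hQ'] at h
  exact key h

end Instance

/-! ### Value tables -/

/-- The position of an argument in the lexicographic order. -/
def tableIndex {k : ℕ} (x : Fin k → Bool) : ℕ := ∑ j : Fin k, if x j then 2 ^ (k - 1 - j : ℕ) else 0

theorem tableIndex_cons {k : ℕ} (b : Bool) (x : Fin k → Bool) :
    tableIndex (Fin.cons b x : Fin (k + 1) → Bool) = (if b then 2 ^ k else 0) + tableIndex x := by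
  rw [tableIndex, Fin.sum_univ_succ]
  simp only [Fin.cons_zero, Fin.cons_succ, Fin.val_zero, Fin.val_succ, tableIndex]
  congr 1
  refine Finset.sum_congr rfl fun j _ => ?_
  rw [show k + 1 - 1 - (j + 1 : ℕ) = k - 1 - j by omega]

theorem tableIndex_lt {k : ℕ} (x : Fin k → Bool) : tableIndex x < 2 ^ k := by
  induction x using Fin.consInduction with
  | elim0 => simp [tableIndex]
  | cons b x ih =>
    rw [tableIndex_cons, pow_succ]
    split_ifs <;> omega

theorem exists_tableIndex {k t : ℕ} (ht : t < 2 ^ k) : ∃ x : Fin k → Bool, tableIndex x = t := by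
  induction k generalizing t with
  | zero => exact ⟨Fin.elim0, by simp at ht; simp [tableIndex, ht]⟩
  | succ k ih =>
    rw [pow_succ] at ht
    by_cases h : t < 2 ^ k
    · obtain ⟨x, rfl⟩ := ih h
      exact ⟨Fin.cons false x, by simp [tableIndex_cons]⟩
    · obtain ⟨x, hx⟩ := ih (t := t - 2 ^ k) (by omega)
      exact ⟨Fin.cons true x, by simp [tableIndex_cons, hx]; omega⟩

theorem testBit_tableIndex {k : ℕ} (x : Fin k → Bool) (j : Fin k) :
    (tableIndex x).testBit (k - 1 - j) = x j := by
  induction x using Fin.consInduction with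
  | elim0 => exact j.elim0
  | @cons k b x ih =>
    rw [tableIndex_cons]
    induction j using Fin.cases with
    | zero =>
      have := Nat.testBit_lt_two_pow (tableIndex_lt x)
      cases b <;> simp [Nat.testBit_two_pow_add_eq, this]
    | succ j =>
      have hj := j.2
      have e : k + 1 - 1 - (j.succ : ℕ) = k - 1 - j := by simp; omega
      rw [e, Fin.cons_succ, ← ih j]
      cases b
      · simp
      · simp only [if_true]
        rw [Nat.testBit_two_pow_add_gt (by omega)]

theorem table_length (k : ℕ) (f : (Fin k → Bool) → ℝ≥0) : (table k f).length = 2 ^ k := by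
  induction k with
  | zero => simp [table]
  | succ k ih => simp [table, ih, pow_succ]; omega

theorem table_getD {k : ℕ} (f : (Fin k → Bool) → ℝ≥0) (x : Fin k → Bool) :
    (table k f).getD (tableIndex x) 0 = f x := by
  induction x using Fin.consInduction with
  | elim0 => simp [table, tableIndex]
  | @cons k b x ih =>
    rw [tableIndex_cons, table]
    cases b
    · rw [List.getD_append _ _ _ _ (by simpa [table_length] using tableIndex_lt x)]
      simpa using ih fun x => f (Fin.cons false x)
    · rw [List.getD_append_right _ _ _ _ (by simp [table_length])]
      simpa [table_length] using ih fun x => f (Fin.cons true x)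

/-! ### Terms as tests -/

/-- The value of the term is not zero. -/
def NTerm.Holds (w : Word) (e : NTerm) (l : List ℕ) : Prop := e.eval w l ≠ 0

namespace NTerm

/-- The subtraction is truncated: `1 - n` is `1` for `n = 0` and `0` otherwise. -/
def lt (a b : NTerm) : NTerm := .sub (.lit 1) (.sub (.add a (.lit 1)) b)

def eq (a b : NTerm) : NTerm := .sub (.lit 1) (.add (.sub a b) (.sub b a))

def not (a : NTerm) : NTerm := .sub (.lit 1) a

variable {w : Word} {l : List ℕ} {a b c : NTerm}

theorem holds_lt : (lt a b).Holds w l ↔ a.eval w l < b.eval w l := by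
  simp only [Holds, lt, eval]; omega

theorem holds_eq : (eq a b).Holds w l ↔ a.eval w l = b.eval w l := by
  simp only [Holds, eq, eval]; omega

theorem holds_not : (not a).Holds w l ↔ ¬ a.Holds w l := by
  simp only [Holds, not, eval]; omega

theorem holds_mul : (mul a b).Holds w l ↔ a.Holds w l ∧ b.Holds w l := by
  simp only [Holds, eval, mul_ne_zero_iff]

theorem holds_add : (add a b).Holds w l ↔ a.Holds w l ∨ b.Holds w l := by
  simp only [Holds, eval]; omega

theorem holds_sum : (sum a).Holds w l ↔ ∃ i < w.size, a.Holds w (i :: l) := by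
  simp [Holds, eval, Finset.sum_eq_zero_iff]

theorem holds_call {θ : List ℕ} : (call θ a).Holds w l ↔ a.Holds w (pick θ l) := Iff.rfl

theorem holds_bind : (bind a b).Holds w l ↔ b.Holds w (a.eval w l :: l) := Iff.rfl

theorem holds_isZero : (isZero a).Holds w l ↔ w.reals.getD (a.eval w l) 0 = 0 := by
  simp [Holds, eval]

theorem holds_lit {n : ℕ} : (lit n).Holds w l ↔ n ≠ 0 := Iff.rfl

open Classical in
theorem eval_ite : (ite c a b).eval w l = if c.Holds w l then a.eval w l else b.eval w l := by
  by_cases h : c.eval w l = 0 <;> simp [eval, Holds, h]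

end NTerm

open Classical in
theorem RTerm.eval_ite {w : Word} {l : List ℕ} {c : NTerm} {a b : RTerm} :
    (RTerm.ite c a b).eval w l = if c.Holds w l then a.eval w l else b.eval w l := by
  by_cases h : c.eval w l = 0 <;> simp [RTerm.eval, NTerm.Holds, h]

theorem sum_range_eq {B k : ℕ} (hk : k ≤ B) {g : ℕ → ℕ} {g' : Fin k → ℕ}
    (h : ∀ i : Fin k, g i = g' i) (h0 : ∀ i, k ≤ i → g i = 0) :
    ∑ i ∈ Finset.range B, g i = ∑ i, g' i := by
  rw [← Finset.sum_subset (Finset.range_mono hk) fun i _ hi => h0 i (by simpa using hi),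
    Finset.sum_range]
  exact Finset.sum_congr rfl fun i _ => h i

theorem prod_range_eq {B k : ℕ} (hk : k ≤ B) {g : ℕ → ℝ} {g' : Fin k → ℝ}
    (h : ∀ i : Fin k, g i = g' i) (h0 : ∀ i, k ≤ i → g i = 1) :
    ∏ i ∈ Finset.range B, g i = ∏ i, g' i := by
  rw [← Finset.prod_subset (Finset.range_mono hk) fun i _ hi => h0 i (by simpa using hi),
    Finset.prod_range]
  exact Finset.prod_congr rfl fun i _ => h i

/-! ### Terms for the factors of a constraint -/

section ConstraintTerms

open NTerm

/-- Environment `[e]`: the value `2 ^ e`. -/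
def powTerm : NTerm :=
  .iter (.lit 1) (.ite (.lt (.var 1) (.var 2)) (.add (.var 0) (.var 0)) (.var 0))

/-- After `i` turns the value is `2 ^ min i e`; hence `e` must not exceed the number of turns. -/
theorem powTerm_eval {w : Word} {e : ℕ} (he : e ≤ w.size) (l : List ℕ) :
    powTerm.eval w (e :: l) = 2 ^ e := by
  have h : ∀ i, (Nat.rec (motive := fun _ => ℕ) 1 (fun i y => (NTerm.ite (.lt (.var 1) (.var 2))
      (.add (.var 0) (.var 0)) (.var 0)).eval w (y :: i :: e :: l)) i : ℕ) = 2 ^ min i e := by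
    intro i
    induction i with
    | zero => simp
    | succ i ih =>
      dsimp only
      rw [ih, eval_ite, holds_lt]
      simp only [eval, List.getD_cons_zero, List.getD_cons_succ]
      split_ifs with h
      · rw [min_eq_left h.le, min_eq_left (by omega), pow_succ]; ring
      · rw [min_eq_right (by omega), min_eq_right (by omega)]
  exact (h w.size).trans (by rw [min_eq_right he])

/-- Environment `[t, j, k]`: the bit of `t` with weight `2 ^ (k - 1 - j)`. -/
def bitTerm : NTerm :=
  .bind (.sub (.sub (.var 2) (.lit 1)) (.var 1)) <| .bind (.call [0] powTerm) <| .sum <|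
    .mul (.lt (.var 3) (.mul (.add (.add (.var 0) (.var 0)) (.lit 2)) (.var 1)))
      (.lt (.mul (.add (.add (.var 0) (.var 0)) (.lit 1)) (.var 1)) (.add (.var 3) (.lit 1)))

/-- With `P = 2 ^ (k - 1 - j)`, the bit is set exactly when `(2h + 1) P ≤ t < (2h + 2) P` for some
`h`. The only candidate `t / P / 2` is at most `t`, so it is in the range of the loop. -/
theorem bitTerm_holds {w : Word} {t j k : ℕ} (hk : k ≤ w.size) (ht : t < w.size) :
    bitTerm.Holds w [t, j, k] ↔ t.testBit (k - 1 - j) = true := by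
  have hP : powTerm.eval w (pick [0] [k - 1 - j, t, j, k]) = 2 ^ (k - 1 - j) :=
    powTerm_eval (e := k - 1 - j) (by omega) _
  simp only [bitTerm, holds_bind, holds_sum, holds_mul, holds_lt, eval, List.getD_cons_zero,
    List.getD_cons_succ, hP]
  rw [Nat.testBit_eq_decide_div_mod_eq, decide_eq_true_iff]
  have hpos : 0 < 2 ^ (k - 1 - j) := by positivity
  generalize 2 ^ (k - 1 - j) = P at hpos
  constructor
  · rintro ⟨h, -, h₁, h₂⟩
    have : t / P = h + h + 1 := by
      refine Nat.div_eq_of_lt_le (Nat.le_of_lt_succ h₂) ?_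
      convert h₁ using 1
    omega
  · intro h
    refine ⟨t / P / 2, ?_, ?_, ?_⟩
    · have := Nat.div_le_self t P
      omega
    · rw [show t / P / 2 + t / P / 2 + 2 = t / P + 1 by omega]
      exact Nat.lt_mul_of_div_lt (Nat.lt_succ_self _) hpos
    · rw [show t / P / 2 + t / P / 2 + 1 = t / P by omega]
      have := Nat.div_mul_le_self t P
      omega

/-- Environment `[t, k, o]`: the entry `t` of the table of length `2 ^ k` at `o` is nonzero. -/
def suppTerm : NTerm :=
  .mul (.lt (.var 0) (.call [1] powTerm)) (.not (.isZero (.add (.var 2) (.var 0))))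

/-- Environment `[p, k, o]`: the variable `p` takes the value `b` on the support. -/
def takesTerm (b : Bool) : NTerm :=
  .sum (.mul (.call [0, 2, 3] suppTerm)
    (if b then .call [0, 1, 2] bitTerm else .not (.call [0, 1, 2] bitTerm)))

/-- Environment `[p, q, k, o]`. -/
def impliesTerm : NTerm :=
  .not (.sum (.mul (.call [0, 3, 4] suppTerm)
    (.mul (.call [0, 1, 3] bitTerm) (.not (.call [0, 2, 3] bitTerm)))))

/-- Environment `[p, k, o]`. -/
def isRepTerm : NTerm :=
  .mul (takesTerm true) (.mul (takesTerm false) (.not (.sum (.mul (.lt (.var 0) (.var 1))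
    (.mul (.call [1, 0, 2, 3] impliesTerm) (.call [0, 1, 2, 3] impliesTerm))))))

/-- Environment `[p, q, k, o]`. -/
def incompTerm : NTerm :=
  .mul (.lt (.var 0) (.var 1)) (.mul (.call [0, 2, 3] isRepTerm) (.mul (.call [1, 2, 3] isRepTerm)
    (.mul (.not impliesTerm) (.not (.call [1, 0, 2, 3] impliesTerm)))))

/-- Environment `[j, p, q, k, o]`. -/
def consequencesTerm (a b : Bool) : NTerm :=
  .mul (.add (.call [1, 0, 3, 4] impliesTerm) (.call [2, 0, 3, 4] impliesTerm))
    (.mul (.not (.mul (.lit a.toNat) (.call [0, 1, 3, 4] impliesTerm)))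
      (.not (.mul (.lit b.toNat) (.call [0, 2, 3, 4] impliesTerm))))

/-- Environment `[p, q, k, o]`: the value of the constraint at the set of consequences. -/
def valueTerm (a b : Bool) : RTerm :=
  .getR (.add (.var 3) (.sum (.ite (.mul (.lt (.var 0) (.var 3)) (consequencesTerm a b))
    (.bind (.sub (.sub (.var 3) (.lit 1)) (.var 0)) powTerm) (.lit 0))))

/-- Environment `[p, q, k, o]`. -/
def edgeTerm : RTerm :=
  .ite incompTerm (.div (.mul (valueTerm false false) (valueTerm true true))
    (.mul (valueTerm true false) (valueTerm false true))) (.lit 1)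

/-- Environment `[q, k, o]`. -/
def vertexTerm : RTerm :=
  .mul (.ite (takesTerm true) (.ite isRepTerm
      (.call [0, 0, 1, 2] (.div (valueTerm false false) (valueTerm true true))) (.lit 1)) (.lit 0))
    (.prod (.ite (.lt (.var 0) (.var 2)) edgeTerm (.lit 1)))

/-- The real part of the word has the table of `f` at the position `o`. -/
structure TableAt (w : Word) {k : ℕ} (f : (Fin k → Bool) → ℝ≥0) (o : ℕ) : Prop where
  arity_le : k ≤ w.size
  pow_le : 2 ^ k ≤ w.size
  getD_eq : ∀ x, w.reals.getD (o + tableIndex x) 0 = f x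

variable {w : Word} {k o : ℕ} {f : (Fin k → Bool) → ℝ≥0}

/-- A search over the support becomes a search over table positions, which fits into one loop
because the table is part of the input. The test `t < 2 ^ k` in `suppTerm` keeps the search away
from the tables that follow. -/
theorem TableAt.exists_supp (h : TableAt w f o) {φ : ℕ → Prop} :
    (∃ t < w.size, suppTerm.Holds w [t, k, o] ∧ φ t) ↔ ∃ x, f x ≠ 0 ∧ φ (tableIndex x) := by
  have hs : ∀ t, suppTerm.Holds w [t, k, o] ↔ t < 2 ^ k ∧ w.reals.getD (o + t) 0 ≠ 0 := by
    intro t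
    have hP : powTerm.eval w (pick [1] [t, k, o]) = 2 ^ k := powTerm_eval h.arity_le _
    simp only [suppTerm, holds_mul, holds_lt, holds_not, holds_isZero, eval, hP,
      List.getD_cons_zero, List.getD_cons_succ, ne_eq]
  simp only [hs]
  constructor
  · rintro ⟨t, -, ⟨ht, h0⟩, hφ⟩
    obtain ⟨x, rfl⟩ := exists_tableIndex ht
    rw [h.getD_eq] at h0
    exact ⟨x, by simpa using h0, hφ⟩
  · rintro ⟨x, hx, hφ⟩
    refine ⟨tableIndex x, (tableIndex_lt x).trans_le h.pow_le, ⟨tableIndex_lt x, ?_⟩, hφ⟩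
    rw [h.getD_eq]
    simpa using hx

theorem TableAt.bit (h : TableAt w f o) (x : Fin k → Bool) (j : Fin k) :
    bitTerm.Holds w [tableIndex x, j, k] ↔ x j = true := by
  rw [bitTerm_holds h.arity_le ((tableIndex_lt x).trans_le h.pow_le), testBit_tableIndex]

theorem TableAt.takes (h : TableAt w f o) (p : Fin k) (b : Bool) :
    (takesTerm b).Holds w [p, k, o] ↔ Takes f p b := by
  cases b
  · simp only [takesTerm, holds_sum, holds_mul, holds_call, Bool.false_eq_true, if_false, holds_not]
    refine (h.exists_supp (φ := fun t => ¬ bitTerm.Holds w [t, p, k])).trans ?_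
    simp only [h.bit, Takes, Bool.not_eq_true]
  · simp only [takesTerm, holds_sum, holds_mul, holds_call, if_true]
    refine (h.exists_supp (φ := fun t => bitTerm.Holds w [t, p, k])).trans ?_
    simp only [h.bit, Takes]

theorem TableAt.implies (h : TableAt w f o) (p q : Fin k) :
    impliesTerm.Holds w [p, q, k, o] ↔ Implies f p q := by
  simp only [impliesTerm, holds_sum, holds_mul, holds_call, holds_not]
  refine (not_congr (h.exists_supp
    (φ := fun t => bitTerm.Holds w [t, p, k] ∧ ¬ bitTerm.Holds w [t, q, k]))).trans ?_
  simp only [h.bit, Implies]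
  push Not
  rfl

theorem TableAt.isRep (h : TableAt w f o) (p : Fin k) :
    isRepTerm.Holds w [p, k, o] ↔ IsRep f p := by
  simp only [isRepTerm, holds_mul, h.takes, holds_not, holds_sum, holds_lt, holds_call, IsRep, eval,
    List.getD_cons_zero, List.getD_cons_succ]
  refine and_congr_right fun _ => and_congr_right fun _ => ?_
  constructor
  · rintro hn q hq ⟨h₁, h₂⟩
    exact hn ⟨q, q.2.trans_le h.arity_le, hq, (h.implies p q).2 h₁, (h.implies q p).2 h₂⟩
  · rintro hn ⟨q, -, hq, h₁, h₂⟩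
    exact hn ⟨q, by omega⟩ hq ⟨(h.implies p ⟨q, by omega⟩).1 h₁, (h.implies ⟨q, by omega⟩ p).1 h₂⟩

theorem TableAt.incomp (h : TableAt w f o) (p q : Fin k) :
    incompTerm.Holds w [p, q, k, o] ↔ Incomp f p q := by
  simp only [incompTerm, holds_mul, holds_not, holds_lt, holds_call, Incomp, eval,
    List.getD_cons_zero, List.getD_cons_succ, h.implies]
  exact and_congr Iff.rfl (and_congr (h.isRep p) (and_congr (h.isRep q)
    (and_congr Iff.rfl (not_congr (h.implies q p)))))

theorem TableAt.consequences (h : TableAt w f o) (j p q : Fin k) (a b : Bool) :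
    (consequencesTerm a b).Holds w [j, p, q, k, o] ↔
      ProdCSP.consequences f p q a b j = true := by
  simp only [consequencesTerm, holds_mul, holds_not, holds_add, holds_call, consequences_eq_true,
    holds_lit]
  refine and_congr (or_congr (h.implies p j) (h.implies q j)) (and_congr
    (not_congr (and_congr ?_ (h.implies j p))) (not_congr (and_congr ?_ (h.implies j q))))
  · cases a <;> simp
  · cases b <;> simp

/-- The lexicographic index of the set of consequences is summed up bit by bit and used as an
address in the table. -/
theorem TableAt.value (h : TableAt w f o) (p q : Fin k) (a b : Bool) :
    (valueTerm a b).eval w [p, q, k, o] = f (ProdCSP.consequences f p q a b) := by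
  classical
  rw [← h.getD_eq, valueTerm, RTerm.eval]
  congr 1
  simp only [eval, List.getD_cons_zero, List.getD_cons_succ]
  congr 1
  refine sum_range_eq h.arity_le ?_ ?_
  · intro j
    have hP : powTerm.eval w [k - 1 - j, (j : ℕ), p, q, k, o] = 2 ^ (k - 1 - j : ℕ) :=
      powTerm_eval (by have := h.arity_le; omega) _
    have hc : ((NTerm.lt (.var 0) (.var 3)).mul (consequencesTerm a b)).Holds w
        [(j : ℕ), p, q, k, o] ↔ ProdCSP.consequences f p q a b j = true := by
      rw [holds_mul, h.consequences, holds_lt]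
      simp [eval]
    have := eval_ite (w := w) (l := [(j : ℕ), p, q, k, o])
      (c := (NTerm.lt (.var 0) (.var 3)).mul (consequencesTerm a b))
      (a := .bind (.sub (.sub (.var 3) (.lit 1)) (.var 0)) powTerm) (b := .lit 0)
    simp only [eval, List.getD_cons_zero, List.getD_cons_succ] at this
    rw [this, hP]
    simp only [hc]
  · intro j hj
    rw [if_pos]
    by_contra hne
    have : (NTerm.lt (.var 0) (.var 3)).Holds w [j, p, q, k, o] :=
      (holds_mul.1 (show ((NTerm.lt (.var 0) (.var 3)).mul (consequencesTerm a b)).Holds w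
        [j, p, q, k, o] from hne)).1
    rw [holds_lt] at this
    simp only [eval, List.getD_cons_zero, List.getD_cons_succ] at this
    omega

theorem TableAt.edge (h : TableAt w f o) (p q : Fin k) :
    edgeTerm.eval w [p, q, k, o] = edgeFactor f p q := by
  rw [edgeTerm, RTerm.eval_ite, edgeFactor]
  by_cases hi : Incomp f p q
  · rw [if_pos ((h.incomp p q).2 hi), if_pos hi]
    simp [RTerm.eval, h.value, interaction]
  · rw [if_neg (mt (h.incomp p q).1 hi), if_neg hi]
    simp [RTerm.eval]

theorem TableAt.vertex (h : TableAt w f o) (q : Fin k) :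
    vertexTerm.eval w [q, k, o] = vertexFactor f q := by
  have hw : (RTerm.call [0, 0, 1, 2] (.div (valueTerm false false) (valueTerm true true))).eval w
      [q, k, o] = weight f q := by
    rw [weight, NNReal.coe_div, ← h.value, ← h.value]
    rfl
  rw [vertexTerm, RTerm.eval, RTerm.eval_ite, RTerm.eval_ite, hw, vertexFactor, NNReal.coe_mul,
    NNReal.coe_prod]
  congr 1
  · by_cases ht : Takes f q true
    · rw [if_pos ((h.takes q true).2 ht), if_pos ht]
      by_cases hr : IsRep f q
      · rw [if_pos ((h.isRep q).2 hr), if_pos hr]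
      · rw [if_neg (mt (h.isRep q).1 hr), if_neg hr]
        simp [RTerm.eval]
    · rw [if_neg (mt (h.takes q true).1 ht), if_neg ht]
      simp [RTerm.eval]
  · rw [RTerm.eval]
    refine prod_range_eq h.arity_le (fun p => ?_) fun p hp => ?_
    · rw [RTerm.eval_ite, if_pos (by rw [holds_lt]; simp [eval])]
      exact h.edge p q
    · rw [RTerm.eval_ite, if_neg (by rw [holds_lt]; simpa [eval] using hp)]
      simp [RTerm.eval]

end ConstraintTerms

/-! ### Reading an encoded instance -/

/-- Serves both parts of the encoding, in which the blocks of the applications have varying lengths.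
-/
theorem getD_flatMap {α β : Type*} (L : List α) (g : α → List β) (i : Fin L.length) (j : ℕ)
    (hj : j < (g L[i]).length) (b : β) :
    (L.flatMap g).getD (((L.take i).flatMap g).length + j) b = (g L[i]).getD j b := by
  have hL : L = L.take i ++ L[i] :: L.drop (i + 1) := by
    rw [Fin.getElem_fin, List.getElem_cons_drop, List.take_append_drop]
  have h : L.flatMap g = (L.take i).flatMap g ++ (g L[i] ++ (L.drop (i + 1)).flatMap g) := by
    rw [← List.flatMap_cons, ← List.flatMap_append, ← hL]
  rw [h, List.getD_append_right _ _ _ _ (by omega), Nat.add_sub_cancel_left,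
    List.getD_append _ _ _ _ hj]

theorem length_flatMap_take_succ {α β : Type*} (L : List α) (g : α → List β) (i : Fin L.length) :
    ((L.take (i + 1)).flatMap g).length = ((L.take i).flatMap g).length + (g L[i]).length := by
  rw [List.take_succ_eq_append_getElem i.2]
  simp

theorem length_le_flatMap {α β : Type*} (L : List α) (g : α → List β) {a : α} (ha : a ∈ L) :
    (g a).length ≤ (L.flatMap g).length := by
  rw [List.length_flatMap]
  exact List.le_sum_of_mem (List.mem_map.2 ⟨a, ha, rfl⟩)

section Encoding

variable {F : Set Constraint} (x : CSPInst F)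

/-- The position in the natural-number part at which the application `i` starts. -/
def CSPInst.natPos (i : ℕ) : ℕ :=
  x.n + 2 + ((x.apps.take i).flatMap fun a =>
    a.h.arity :: List.ofFn fun j => (a.args j : ℕ)).length

/-- The position in the real part at which the table of the application `i` starts. -/
def CSPInst.realPos (i : ℕ) : ℕ :=
  ((x.apps.take i).flatMap fun a => table a.h.arity a.h.val).length

theorem CSPInst.nats_zero : x.enc.nats.getD 0 0 = x.n := rfl

theorem CSPInst.nats_numApps : x.enc.nats.getD (x.n + 1) 0 = x.apps.length := by
  rw [enc, List.getD_cons_succ, List.getD_append_right _ _ _ _ (by simp)]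
  simp

theorem CSPInst.nats_natPos (i : Fin x.apps.length) (j : ℕ) (hj : j < (x.apps[i]).h.arity + 1) :
    x.enc.nats.getD (x.natPos i + j) 0 =
      ((x.apps[i]).h.arity :: List.ofFn fun j => ((x.apps[i]).args j : ℕ)).getD j 0 := by
  rw [← getD_flatMap x.apps (fun a => a.h.arity :: List.ofFn fun j => (a.args j : ℕ)) i j
    (by simpa using hj)]
  rw [natPos, enc]
  set R := ((x.apps.take i).flatMap fun a =>
    a.h.arity :: List.ofFn fun j => (a.args j : ℕ)).length
  rw [show x.n + 2 + R + j = (x.n + (R + j + 1)) + 1 by omega, List.getD_cons_succ,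
    List.getD_append_right _ _ _ _ (by simp), List.length_range, Nat.add_sub_cancel_left,
    List.getD_cons_succ]

theorem CSPInst.nats_arity (i : Fin x.apps.length) :
    x.enc.nats.getD (x.natPos i) 0 = (x.apps[i]).h.arity :=
  x.nats_natPos i 0 (by omega)

theorem CSPInst.nats_arg (i : Fin x.apps.length) (q : Fin (x.apps[i]).h.arity) :
    x.enc.nats.getD (x.natPos i + 1 + q) 0 = x.arg i q := by
  rw [Nat.add_assoc, x.nats_natPos i (1 + q) (by omega), Nat.add_comm 1, List.getD_cons_succ,
    List.getD_eq_getElem _ _ (by simp)]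
  simp [arg]

theorem CSPInst.natPos_succ (i : Fin x.apps.length) :
    x.natPos (i + 1) = x.natPos i + 1 + (x.apps[i]).h.arity := by
  rw [natPos, natPos, length_flatMap_take_succ]
  simp
  omega

theorem CSPInst.realPos_succ (i : Fin x.apps.length) :
    x.realPos (i + 1) = x.realPos i + 2 ^ (x.apps[i]).h.arity := by
  rw [realPos, realPos, length_flatMap_take_succ, table_length]

theorem CSPInst.n_le_size : x.n ≤ x.enc.size := by
  simp [enc, Word.size]
  omega

theorem CSPInst.length_le_size : x.apps.length ≤ x.enc.size := by
  have : x.apps.length ≤ (x.apps.flatMap fun a =>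
      a.h.arity :: List.ofFn fun j => (a.args j : ℕ)).length := by
    rw [List.length_flatMap]
    refine le_trans ?_ (List.card_nsmul_le_sum _ 1 ?_)
    · simp
    · intro n hn
      obtain ⟨a, -, rfl⟩ := List.mem_map.1 hn
      simp
  simp only [enc, Word.size, List.length_cons, List.length_append]
  omega

/-- The size bounds hold because the encoding lists the arguments of each application and all values
of its constraint. -/
theorem CSPInst.tableAt (i : Fin x.apps.length) : TableAt x.enc (x.fn i) (x.realPos i) := by
  have hmem : x.apps[i] ∈ x.apps := List.getElem_mem i.2
  refine ⟨?_, ?_, fun y => ?_⟩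
  · have := length_le_flatMap x.apps
      (fun a => a.h.arity :: List.ofFn fun j => (a.args j : ℕ)) hmem
    simp only [List.length_cons, List.length_ofFn] at this
    simp only [enc, Word.size, List.length_cons, List.length_append]
    omega
  · have := length_le_flatMap x.apps (fun a => table a.h.arity a.h.val) hmem
    rw [table_length] at this
    simp only [enc, Word.size]
    omega
  · rw [fn, ← table_getD, realPos, enc]
    exact getD_flatMap x.apps (fun a => table a.h.arity a.h.val) i _
      (by rw [table_length]; exact tableIndex_lt y) 0

end Encoding

/-! ### Terms for the flow instance -/

section InstanceTerms

open NTerm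

def sizeTerm : NTerm := .getN (.lit 0)

def numAppsTerm : NTerm := .getN (.add sizeTerm (.lit 1))

/-- Environment `[i]`. -/
def natPosTerm : NTerm :=
  .iter (.add sizeTerm (.lit 2)) (.ite (.lt (.var 1) (.var 2))
    (.add (.add (.var 0) (.lit 1)) (.getN (.var 0))) (.var 0))

/-- Environment `[i]`. -/
def realPosTerm : NTerm :=
  .sum (.ite (.lt (.var 0) (.var 1)) (.bind (.getN (.call [0] natPosTerm)) powTerm) (.lit 0))

/-- Environment `i :: l`; the environment of `b` is `o :: k :: s :: i :: l`, where `k` is the arity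
of the application `i`, and `s` and `o` are its positions in the two parts of the input. -/
def NTerm.withApp (b : NTerm) : NTerm :=
  .bind (.call [0] natPosTerm) (.bind (.getN (.var 0)) (.bind (.call [2] realPosTerm) b))

def RTerm.withApp (b : RTerm) : RTerm :=
  .bind (.call [0] natPosTerm) (.bind (.getN (.var 0)) (.bind (.call [2] realPosTerm) b))

/-- Environment `[z]`. -/
def softInfluxTerm : RTerm :=
  .prod (.ite (.lt (.var 0) numAppsTerm) (.withApp (.prod
    (.ite (.mul (.lt (.var 0) (.var 2)) (.eq (.getN (.add (.add (.var 3) (.lit 1)) (.var 0)))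
      (.var 5))) (.call [0, 2, 1] vertexTerm) (.lit 1)))) (.lit 1))

/-- Environment `[q, p, o, k, s, i, y, z]`: the arguments `p` and `q` exist and are `y` and `z`. -/
def argsTerm : NTerm :=
  .mul (.mul (.lt (.var 1) (.var 3)) (.lt (.var 0) (.var 3)))
    (.mul (.eq (.getN (.add (.add (.var 4) (.lit 1)) (.var 1))) (.var 6))
      (.eq (.getN (.add (.add (.var 4) (.lit 1)) (.var 0))) (.var 7)))

/-- Environment `[y, z]`. -/
def softRateTerm : RTerm :=
  .prod (.ite (.lt (.var 0) numAppsTerm) (.withApp (.prod (.prod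
    (.ite argsTerm (.call [1, 0, 3, 2] edgeTerm) (.lit 1))))) (.lit 1))

/-- Environment `[z]`. -/
def hardVertexTerm : NTerm :=
  .sum (.mul (.lt (.var 0) numAppsTerm) (.withApp (.sum (.mul
    (.mul (.lt (.var 0) (.var 2)) (.eq (.getN (.add (.add (.var 3) (.lit 1)) (.var 0))) (.var 5)))
    (.not (.call [0, 2, 1] (takesTerm false)))))))

/-- Environment `[y, z]`. -/
def hardEdgeTerm : NTerm :=
  .sum (.mul (.lt (.var 0) numAppsTerm) (.withApp (.sum (.sum
    (.mul argsTerm (.call [0, 1, 3, 2] impliesTerm))))))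

/-- The factor for the penalty that comes from a rate. -/
def spreadTerm (a : RTerm) : RTerm := .mul (.add (.lit 1) a) (.add (.lit 1) (.div (.lit 1) a))

def penaltyTerm : RTerm :=
  .mul (.lit 2) (.mul
    (.prod (.ite (.lt (.var 0) sizeTerm) (spreadTerm (.call [0] softInfluxTerm)) (.lit 1)))
    (.prod (.ite (.lt (.var 0) sizeTerm)
      (.prod (.ite (.lt (.var 0) sizeTerm) (spreadTerm (.call [1, 0] softRateTerm)) (.lit 1)))
      (.lit 1))))

/-- Environment `[z]`. -/
def influxTerm : RTerm := .mul softInfluxTerm (.ite hardVertexTerm penaltyTerm (.lit 1))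

/-- Environment `[y, z]`. -/
def rateTerm : RTerm := .mul softRateTerm (.ite hardEdgeTerm penaltyTerm (.lit 1))

/-- Run a command for all vertices. -/
def Cmd.vertices (a : Cmd) : Cmd := .loop (.guard (.lt (.var 0) sizeTerm) a)

/-- The command that emits the flow instance. -/
def flowCmd : Cmd :=
  .seq (.seq (.emitN sizeTerm) (.seq (.emitN (.mul sizeTerm sizeTerm))
      (.vertices (.vertices (.seq (.emitN (.var 1)) (.emitN (.var 0)))))))
    (.seq (.vertices (.emitR (.call [0] influxTerm)))
      (.vertices (.vertices (.emitR (.call [1, 0] rateTerm)))))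

variable {F : Set Constraint} (x : CSPInst F)

theorem sizeTerm_eval (l : List ℕ) : sizeTerm.eval x.enc l = x.n := x.nats_zero

theorem numAppsTerm_eval (l : List ℕ) : numAppsTerm.eval x.enc l = x.apps.length := by
  rw [← x.nats_numApps, ← sizeTerm_eval x l]
  rfl

/-- A block starts with its arity, so the start of the next block can be computed from the start of
the present one. The position stays frozen after `i` turns. -/
theorem natPosTerm_eval {i : ℕ} (hi : i ≤ x.apps.length) (l : List ℕ) :
    natPosTerm.eval x.enc (i :: l) = x.natPos i := by
  have h : ∀ r, (Nat.rec (motive := fun _ => ℕ) (x.n + 2) (fun r y =>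
      (NTerm.ite (.lt (.var 1) (.var 2)) (.add (.add (.var 0) (.lit 1)) (.getN (.var 0)))
        (.var 0)).eval x.enc (y :: r :: i :: l)) r : ℕ) = x.natPos (min r i) := by
    intro r
    induction r with
    | zero => simp [CSPInst.natPos]
    | succ r ih =>
      dsimp only
      rw [ih, eval_ite, holds_lt]
      simp only [eval, List.getD_cons_zero, List.getD_cons_succ]
      split_ifs with h
      · have := x.natPos_succ ⟨r, by omega⟩
        rw [min_eq_left h.le, min_eq_left (by omega), this, ← x.nats_arity]
      · rw [min_eq_right (by omega), min_eq_right (by omega)]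
  exact (h x.enc.size).trans (by rw [min_eq_right (hi.trans x.length_le_size)])

/-- The tables carry no length marks; their lengths are obtained from the arities in the
natural-number part. -/
theorem realPosTerm_eval {i : ℕ} (hi : i ≤ x.apps.length) (l : List ℕ) :
    realPosTerm.eval x.enc (i :: l) = x.realPos i := by
  have h : ∀ r, ∑ r ∈ Finset.range r, (NTerm.ite (.lt (.var 0) (.var 1))
      (.bind (.getN (.call [0] natPosTerm)) powTerm) (.lit 0)).eval x.enc (r :: i :: l) =
        x.realPos (min r i) := by
    intro r
    induction r with
    | zero => simp [CSPInst.realPos]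
    | succ r ih =>
      rw [Finset.sum_range_succ, ih, eval_ite, holds_lt]
      simp only [eval, List.getD_cons_zero, List.getD_cons_succ]
      split_ifs with h
      · have hr : natPosTerm.eval x.enc (pick [0] (r :: i :: l)) = x.natPos r :=
          natPosTerm_eval x (i := r) (by omega) []
        have := x.realPos_succ ⟨r, by omega⟩
        rw [min_eq_left h.le, min_eq_left (by omega), this, hr,
          x.nats_arity ⟨r, by omega⟩, powTerm_eval (x.tableAt ⟨r, by omega⟩).arity_le]
      · rw [min_eq_right (by omega), min_eq_right (by omega), Nat.add_zero]
  exact (h x.enc.size).trans (by rw [min_eq_right (hi.trans x.length_le_size)])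

theorem withApp_env (i : Fin x.apps.length) (l : List ℕ) :
    natPosTerm.eval x.enc (pick [0] (i :: l)) = x.natPos i ∧
    realPosTerm.eval x.enc (pick [2] ((x.apps[i]).h.arity :: x.natPos i :: i :: l)) =
      x.realPos i :=
  ⟨natPosTerm_eval x i.2.le [], realPosTerm_eval x i.2.le []⟩

theorem NTerm.withApp_holds (b : NTerm) (i : Fin x.apps.length) (l : List ℕ) :
    b.withApp.Holds x.enc (i :: l) ↔
      b.Holds x.enc (x.realPos i :: (x.apps[i]).h.arity :: x.natPos i :: i :: l) := by
  obtain ⟨h₁, h₂⟩ := withApp_env x i l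
  simp only [NTerm.withApp, holds_bind, eval, h₁, List.getD_cons_zero, x.nats_arity, h₂]

theorem RTerm.withApp_eval (b : RTerm) (i : Fin x.apps.length) (l : List ℕ) :
    b.withApp.eval x.enc (i :: l) =
      b.eval x.enc (x.realPos i :: (x.apps[i]).h.arity :: x.natPos i :: i :: l) := by
  obtain ⟨h₁, h₂⟩ := withApp_env x i l
  simp only [RTerm.withApp, RTerm.eval, NTerm.eval, h₁, List.getD_cons_zero, x.nats_arity, h₂]

/-- A product over all applications. -/
theorem prod_apps_eval (b : RTerm) (l : List ℕ) {g : Fin x.apps.length → ℝ}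
    (h : ∀ i : Fin x.apps.length, b.eval x.enc
      (x.realPos i :: (x.apps[i]).h.arity :: x.natPos i :: i :: l) = g i) :
    (RTerm.prod (.ite (.lt (.var 0) numAppsTerm) b.withApp (.lit 1))).eval x.enc l = ∏ i, g i := by
  rw [RTerm.eval]
  refine prod_range_eq x.length_le_size (fun i => ?_) fun i hi => ?_
  · rw [RTerm.eval_ite, if_pos (by rw [holds_lt, numAppsTerm_eval]; simp [NTerm.eval]),
      RTerm.withApp_eval, h]
  · rw [RTerm.eval_ite, if_neg (by rw [holds_lt, numAppsTerm_eval]; simpa [NTerm.eval] using hi)]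
    simp [RTerm.eval]

theorem exists_apps_holds (b : NTerm) (l : List ℕ) {φ : Fin x.apps.length → Prop}
    (h : ∀ i : Fin x.apps.length, b.Holds x.enc
      (x.realPos i :: (x.apps[i]).h.arity :: x.natPos i :: i :: l) ↔ φ i) :
    (NTerm.sum (.mul (.lt (.var 0) numAppsTerm) b.withApp)).Holds x.enc l ↔ ∃ i, φ i := by
  simp only [holds_sum, holds_mul, holds_lt, numAppsTerm_eval, NTerm.eval, List.getD_cons_zero]
  constructor
  · rintro ⟨i, -, hi, hb⟩
    exact ⟨⟨i, hi⟩, (h ⟨i, hi⟩).1 ((NTerm.withApp_holds x b ⟨i, hi⟩ l).1 hb)⟩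
  · rintro ⟨i, hi⟩
    exact ⟨i, i.2.trans_le x.length_le_size, i.2, (NTerm.withApp_holds x b i l).2 ((h i).2 hi)⟩

/-- A product over all vertices. -/
theorem prod_vertices_eval (b : RTerm) (l : List ℕ) {g : Fin x.n → ℝ}
    (h : ∀ z : Fin x.n, b.eval x.enc (z :: l) = g z) :
    (RTerm.prod (.ite (.lt (.var 0) sizeTerm) b (.lit 1))).eval x.enc l = ∏ z, g z := by
  rw [RTerm.eval]
  refine prod_range_eq x.n_le_size (fun i => ?_) fun i hi => ?_
  · rw [RTerm.eval_ite, if_pos (by rw [holds_lt, sizeTerm_eval]; simp [NTerm.eval]), h]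
  · rw [RTerm.eval_ite, if_neg (by rw [holds_lt, sizeTerm_eval]; simpa [NTerm.eval] using hi)]
    simp [RTerm.eval]

/-- The loop over `q` runs past the arity, where the address leaves the block of the application;
the first test excludes these turns. -/
theorem vertexArg_holds (i : Fin x.apps.length) (z : Fin x.n) (q : ℕ) :
    (NTerm.mul (.lt (.var 0) (.var 2)) (.eq (.getN (.add (.add (.var 3) (.lit 1)) (.var 0)))
      (.var 5))).Holds x.enc [q, x.realPos i, (x.apps[i]).h.arity, x.natPos i, i, z] ↔
      ∃ h : q < (x.apps[i]).h.arity, x.arg i ⟨q, h⟩ = z := by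
  simp only [holds_mul, holds_lt, holds_eq, NTerm.eval, List.getD_cons_zero, List.getD_cons_succ]
  constructor
  · rintro ⟨h, h'⟩
    exact ⟨h, Fin.ext ((x.nats_arg i ⟨q, h⟩).symm.trans h')⟩
  · rintro ⟨h, h'⟩
    exact ⟨h, (x.nats_arg i ⟨q, h⟩).trans (congrArg _ h')⟩

theorem argsTerm_holds (i : Fin x.apps.length) (y z : Fin x.n) (p q : ℕ) :
    argsTerm.Holds x.enc [q, p, x.realPos i, (x.apps[i]).h.arity, x.natPos i, i, y, z] ↔
      ∃ (h : p < (x.apps[i]).h.arity) (h' : q < (x.apps[i]).h.arity),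
        x.arg i ⟨p, h⟩ = y ∧ x.arg i ⟨q, h'⟩ = z := by
  simp only [argsTerm, holds_mul, holds_lt, holds_eq, NTerm.eval, List.getD_cons_zero,
    List.getD_cons_succ]
  constructor
  · rintro ⟨⟨h, h'⟩, h₁, h₂⟩
    exact ⟨h, h', Fin.ext ((x.nats_arg i ⟨p, h⟩).symm.trans h₁),
      Fin.ext ((x.nats_arg i ⟨q, h'⟩).symm.trans h₂)⟩
  · rintro ⟨h, h', h₁, h₂⟩
    exact ⟨⟨h, h'⟩, (x.nats_arg i ⟨p, h⟩).trans (congrArg _ h₁),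
      (x.nats_arg i ⟨q, h'⟩).trans (congrArg _ h₂)⟩

theorem softInfluxTerm_eval (z : Fin x.n) :
    softInfluxTerm.eval x.enc [z] = x.softInflux z := by
  rw [CSPInst.softInflux, NNReal.coe_prod]
  refine prod_apps_eval x _ [z] fun i => ?_
  rw [RTerm.eval, NNReal.coe_prod]
  refine prod_range_eq (x.tableAt i).arity_le (fun q => ?_) fun q hq => ?_
  · rw [RTerm.eval_ite]
    by_cases h : x.arg i q = z
    · rw [if_pos ((vertexArg_holds x i z q).2 ⟨q.2, h⟩), if_pos h]
      exact (x.tableAt i).vertex q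
    · rw [if_neg (mt (vertexArg_holds x i z q).1 fun h' => h h'.2), if_neg h]
      simp [RTerm.eval]
  · rw [RTerm.eval_ite, if_neg (mt (vertexArg_holds x i z q).1 fun h' => by
      have := h'.1
      omega)]
    simp [RTerm.eval]

theorem softRateTerm_eval (y z : Fin x.n) :
    softRateTerm.eval x.enc [y, z] = x.softRate y z := by
  rw [CSPInst.softRate, NNReal.coe_prod]
  refine prod_apps_eval x _ [y, z] fun i => ?_
  rw [RTerm.eval, NNReal.coe_prod]
  refine prod_range_eq (x.tableAt i).arity_le (fun p => ?_) fun p hp => ?_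
  · rw [RTerm.eval, NNReal.coe_prod]
    refine prod_range_eq (x.tableAt i).arity_le (fun q => ?_) fun q hq => ?_
    · rw [RTerm.eval_ite]
      by_cases h : x.arg i p = y ∧ x.arg i q = z
      · rw [if_pos ((argsTerm_holds x i y z p q).2 ⟨p.2, q.2, h⟩), if_pos h]
        exact (x.tableAt i).edge p q
      · rw [if_neg (mt (argsTerm_holds x i y z p q).1 fun ⟨_, _, h'⟩ => h h'), if_neg h]
        simp [RTerm.eval]
    · rw [RTerm.eval_ite, if_neg (mt (argsTerm_holds x i y z p q).1 fun ⟨_, h', _⟩ => by omega)]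
      simp [RTerm.eval]
  · rw [RTerm.eval]
    refine Finset.prod_eq_one fun q _ => ?_
    rw [RTerm.eval_ite, if_neg (mt (argsTerm_holds x i y z p q).1 fun ⟨h', _⟩ => by omega)]
    simp [RTerm.eval]

theorem hardVertexTerm_holds (z : Fin x.n) :
    hardVertexTerm.Holds x.enc [z] ↔ x.HardVertex z := by
  refine exists_apps_holds x _ [z] fun i => ?_
  rw [holds_sum]
  constructor
  · rintro ⟨q, -, h⟩
    rw [holds_mul, holds_not] at h
    obtain ⟨hq, h'⟩ := (vertexArg_holds x i z q).1 h.1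
    exact ⟨⟨q, hq⟩, h', mt ((x.tableAt i).takes ⟨q, hq⟩ false).2 h.2⟩
  · rintro ⟨q, hq, h⟩
    refine ⟨q, q.2.trans_le (x.tableAt i).arity_le, ?_⟩
    rw [holds_mul, holds_not]
    exact ⟨(vertexArg_holds x i z q).2 ⟨q.2, hq⟩, mt ((x.tableAt i).takes q false).1 h⟩

theorem hardEdgeTerm_holds (y z : Fin x.n) :
    hardEdgeTerm.Holds x.enc [y, z] ↔ x.HardEdge y z := by
  refine exists_apps_holds x _ [y, z] fun i => ?_
  simp only [holds_sum, holds_mul]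
  constructor
  · rintro ⟨p, -, q, -, h, h'⟩
    obtain ⟨hp, hq, h₁, h₂⟩ := (argsTerm_holds x i y z p q).1 h
    exact ⟨⟨p, hp⟩, ⟨q, hq⟩, h₁, h₂, ((x.tableAt i).implies ⟨q, hq⟩ ⟨p, hp⟩).1 h'⟩
  · rintro ⟨p, q, h₁, h₂, h⟩
    exact ⟨p, p.2.trans_le (x.tableAt i).arity_le, q, q.2.trans_le (x.tableAt i).arity_le,
      (argsTerm_holds x i y z p q).2 ⟨p.2, q.2, h₁, h₂⟩, ((x.tableAt i).implies q p).2 h⟩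

/-- Machine division and division in `ℝ≥0` share the convention `1 / 0 = 0`, so zero influx rates
need no special case. -/
theorem penaltyTerm_eval (l : List ℕ) : penaltyTerm.eval x.enc l = x.penalty := by
  have hs : ∀ (a : RTerm) (l : List ℕ) (r : ℝ≥0), a.eval x.enc l = r →
      (spreadTerm a).eval x.enc l = ((1 + r) * (1 + 1 / r) : ℝ≥0) := by
    intro a l r h
    simp [spreadTerm, RTerm.eval, h]
  rw [CSPInst.penalty, NNReal.coe_mul, NNReal.coe_mul, NNReal.coe_prod, NNReal.coe_prod]
  refine congrArg₂ (· * ·) (by simp [RTerm.eval]) (congrArg₂ (· * ·) ?_ ?_)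
  · exact prod_vertices_eval x _ l fun z =>
      hs (.call [0] softInfluxTerm) (z :: l) _ (softInfluxTerm_eval x z)
  · refine prod_vertices_eval x _ l fun y => ?_
    rw [NNReal.coe_prod]
    exact prod_vertices_eval x _ (y :: l) fun z =>
      hs (.call [1, 0] softRateTerm) (z :: y :: l) _ (softRateTerm_eval x y z)

theorem influxTerm_eval (z : Fin x.n) : influxTerm.eval x.enc [z] = x.influx z := by
  rw [influxTerm, RTerm.eval, softInfluxTerm_eval, RTerm.eval_ite, CSPInst.influx, NNReal.coe_mul]
  congr 1
  by_cases h : x.HardVertex z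
  · rw [if_pos ((hardVertexTerm_holds x z).2 h), if_pos h, penaltyTerm_eval]
  · rw [if_neg (mt (hardVertexTerm_holds x z).1 h), if_neg h]
    simp [RTerm.eval]

theorem rateTerm_eval (y z : Fin x.n) : rateTerm.eval x.enc [y, z] = x.rate y z := by
  rw [rateTerm, RTerm.eval, softRateTerm_eval, RTerm.eval_ite, CSPInst.rate, NNReal.coe_mul]
  congr 1
  by_cases h : x.HardEdge y z
  · rw [if_pos ((hardEdgeTerm_holds x y z).2 h), if_pos h, penaltyTerm_eval]
  · rw [if_neg (mt (hardEdgeTerm_holds x y z).1 h), if_neg h]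
    simp [RTerm.eval]

theorem flatMap_range_eq {α : Type*} {B n : ℕ} (hn : n ≤ B) {g : ℕ → List α}
    {g' : Fin n → List α} (h : ∀ i : Fin n, g i = g' i) (h0 : ∀ i, n ≤ i → g i = []) :
    (List.range B).flatMap g = (List.finRange n).flatMap g' := by
  obtain ⟨d, rfl⟩ := Nat.exists_eq_add_of_le hn
  have hd : (List.range d).flatMap (fun i => g (n + i)) = [] :=
    List.flatMap_eq_nil_iff.2 fun i _ => h0 _ (by omega)
  rw [List.range_add, List.flatMap_append, List.flatMap_map, hd, List.append_nil,
    ← List.map_coe_finRange_eq_range, List.flatMap_map]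
  exact List.flatMap_congr fun i _ => h i

theorem vertices_outN (a : Cmd) (l : List ℕ) {g : Fin x.n → List ℕ}
    (h : ∀ z : Fin x.n, a.outN x.enc (z :: l) = g z) :
    a.vertices.outN x.enc l = (List.finRange x.n).flatMap g := by
  refine flatMap_range_eq x.n_le_size (fun i => ?_) fun i hi => ?_
  · rw [← h, Cmd.outN, if_neg]
    exact (holds_lt (a := .var 0) (b := sizeTerm)).2 (by simp [sizeTerm_eval, NTerm.eval])
  · rw [Cmd.outN, if_pos]
    by_contra hc
    have := (holds_lt (a := .var 0) (b := sizeTerm)).1 hc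
    simp only [sizeTerm_eval, NTerm.eval, List.getD_cons_zero] at this
    omega

theorem vertices_outR (a : Cmd) (l : List ℕ) {g : Fin x.n → List ℝ}
    (h : ∀ z : Fin x.n, a.outR x.enc (z :: l) = g z) :
    a.vertices.outR x.enc l = (List.finRange x.n).flatMap g := by
  refine flatMap_range_eq x.n_le_size (fun i => ?_) fun i hi => ?_
  · rw [← h, Cmd.outR, if_neg]
    exact (holds_lt (a := .var 0) (b := sizeTerm)).2 (by simp [sizeTerm_eval, NTerm.eval])
  · rw [Cmd.outR, if_pos]
    by_contra hc
    have := (holds_lt (a := .var 0) (b := sizeTerm)).1 hc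
    simp only [sizeTerm_eval, NTerm.eval, List.getD_cons_zero] at this
    omega

theorem vertices_outN_nil {a : Cmd} (l : List ℕ) (h : ∀ z : Fin x.n, a.outN x.enc (z :: l) = []) :
    a.vertices.outN x.enc l = [] := by
  rw [vertices_outN x a l h]; simp

theorem vertices_outR_nil {a : Cmd} (l : List ℕ) (h : ∀ z : Fin x.n, a.outR x.enc (z :: l) = []) :
    a.vertices.outR x.enc l = [] := by
  rw [vertices_outR x a l h]; simp

/-- The graph is complete with loops, so it has `n * n` edges; the nested loops run through them row
by row, in the order of `CSPInst.toFlow`, for the ends as well as for the rates. -/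
theorem flowCmd_out (hF : F ⊆ IMopt) :
    (x.toFlow hF).enc = ⟨flowCmd.outN x.enc [], flowCmd.outR x.enc []⟩ := by
  rw [FlowInst.enc, Word.mk.injEq]
  constructor
  · have h₁ : (Cmd.vertices (.vertices (.seq (.emitN (.var 1)) (.emitN (.var 0))))).outN x.enc [] =
        (List.finRange x.n).flatMap fun y : Fin x.n => (List.finRange x.n).flatMap
          fun z : Fin x.n => [(y : ℕ), (z : ℕ)] :=
      vertices_outN x _ _ fun y => vertices_outN x _ _ fun z => rfl
    have h₂ : (Cmd.vertices (.emitR (.call [0] influxTerm))).outN x.enc [] = [] :=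
      vertices_outN_nil x _ fun y => rfl
    have h₃ : (Cmd.vertices (.vertices (.emitR (.call [1, 0] rateTerm)))).outN x.enc [] = [] :=
      vertices_outN_nil x _ fun y => vertices_outN_nil x _ fun z => rfl
    simp only [flowCmd, Cmd.outN, h₁, h₂, h₃, NTerm.eval, sizeTerm_eval]
    simp [CSPInst.toFlow, List.flatMap_assoc, List.flatMap_map, List.length_flatMap]
  · have h₁ : (Cmd.vertices (.vertices (.seq (.emitN (.var 1)) (.emitN (.var 0))))).outR x.enc [] =
        [] := vertices_outR_nil x _ fun y => vertices_outR_nil x _ fun z => rfl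
    have h₂ : (Cmd.vertices (.emitR (.call [0] influxTerm))).outR x.enc [] =
        (List.finRange x.n).flatMap fun z => [(x.influx z : ℝ)] :=
      vertices_outR x _ _ fun z => congrArg (fun r => [r]) (influxTerm_eval x z)
    have h₃ : (Cmd.vertices (.vertices (.emitR (.call [1, 0] rateTerm)))).outR x.enc [] =
        (List.finRange x.n).flatMap fun y => (List.finRange x.n).flatMap fun z =>
          [(x.rate y z : ℝ)] :=
      vertices_outR x _ _ fun y => vertices_outR x _ _ fun z =>
        congrArg (fun r => [r]) (rateTerm_eval x y z)
    simp only [flowCmd, Cmd.outR, h₁, h₂, h₃]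
    simp [CSPInst.toFlow, List.map_flatMap, List.ofFn_eq_map, ← List.map_eq_flatMap,
      Function.comp_def]

end InstanceTerms

/-- Every unary constraint is a product of unary constraints. -/
theorem unaryConstraints_subset_IMopt : unaryConstraints ⊆ IMopt := by
  rintro ⟨k, f⟩ (rfl : k = 1)
  refine ⟨[.unary 0 fun b => f fun _ => b], fun x => ?_⟩
  simp only [List.map_cons, List.map_nil, List.prod_cons, List.prod_nil, mul_one, ImFactor.eval]
  congr 1
  funext i
  rw [Subsingleton.elim i 0]

end ProdCSP

theorem mainTheorem8 (F : Set ProdCSP.Constraint) (hF : F ⊆ ProdCSP.IMopt) :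
    (ProdCSP.maxProdCSPStar F).APTReducible ProdCSP.maxProdFlow := by
  -- The free unary constraints lie in `IMopt` as well, so they go through the same construction as
  -- the constraints of `F`.
  have hF' : F ∪ ProdCSP.unaryConstraints ⊆ ProdCSP.IMopt :=
    Set.union_subset hF ProdCSP.unaryConstraints_subset_IMopt
  refine ProdCSP.MaxProblem.APTReducible.of_cmd ProdCSP.flowCmd fun x =>
    ⟨ProdCSP.CSPInst.toFlow x hF', ProdCSP.flowCmd_out x hF', fun ε _ hε y hy => ?_⟩
  exact ⟨y, rfl, ProdCSP.CSPInst.isApprox_of_toFlow x hF' hε y hy⟩
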